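/- **Setting.** A *threshold function* is a real function $\Theta(t;\lambda)$, $t\in\mathbb R$, $0\le\lambda<\infty$, such that for every $\lambda$: $\Theta(-t;\lambda)=-\Theta(t;\lambda)$; $\Theta(\cdot;\lambda)$ is nondecreasing; $\Theta(t;\lambda)\to\infty$ as $t\to\infty$; and $0\le\Theta(t;\lambda)\le t$ for $t\ge 0$. Put $\Theta^{-1}(u;\lambda)=\sup\{t:\Theta(t;\lambda)\le u\}$, and let $\mathcal L_\Theta\in[0,1]$ be a constant, independent of $\lambda$, with $\frac{d}{du}\Theta^{-1}(u;\lambda)\ge 1-\mathcal L_\Theta$ for almost every $u>0$. Let $P$ be any function such that, for all $\theta\in\mathbb R$ and $\lambda\ge 0$, $$P(\theta;\lambda)-P(0;\lambda)=\int_0^{|\theta|}\bigl(\Theta^{-1}(u;\lambda)-u\bigr)\,du+q(\theta;\lambda),$$ where $q(\cdot;\lambda)\ge 0$ and $q(\Theta(t;\lambda);\lambda)=0$ for all $t$. For $M\in\mathbb R^{p\times m}$ with singular values $\sigma_1\ge\dots\ge\sigma_{p\wedge m}$ and singular value decomposition $M=U\,\mathrm{diag}\{\sigma_s\}V^T$,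 put $\Theta^\sigma(M;\lambda)=U\,\mathrm{diag}\{\Theta(\sigma_s;\lambda)\}V^T$. Fix $\lambda\ge 0$. Consider a natural exponential family with densities $f(y;\theta)=\exp(y\theta-b(\theta)+c(y))$ with respect to a dominating measure on $\mathbb R$, and let $N$ be the interior of its natural parameter space. Let $X=[\tilde x_0,X^\circ]\in\mathbb R^{n\times(p+1)}$ have rows $x_i^T$ and first column $\tilde x_0$, and let $Y\in\mathbb R^{n\times m}$. For $B=[b_1,\dots,b_m]\in\mathbb R^{(p+1)\times m}$ let $\tilde b_0^T$ be its first row and $B^\circ\in\mathbb R^{p\times m}$ the remaining rows. With the canonical link, whose inverse is $b'$, set $$\mu(B)=[b'(x_i^Tb_k)]_{i,k},\qquad \mathcal I(\beta)=X^T\mathrm{diag}\{b''(x_i^T\beta)\}_{i=1}^n X,$$ $$F(B)=-\sum_{k=1}^m\sum_{i=1}^n\log f(y_{ik};x_i^Tb_k)+\sum_{s=1}^{p\wedge m}P(\sigma_s^{(B^\circ)};\lambda).$$ Starting from any $B^{(0)}$, let $B^{(1)},B^{(2)},\dots$ be given by $$B^{\circ(j+1)}=\Theta^\sigma\bigl(B^{\circ(j)}+X^{\circ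 T}Y-X^{\circ T}\mu(B^{(j)});\lambda\bigr),\qquad \tilde b_0^{(j+1)}=\tilde b_0^{(j)}+(Y-\mu(B^{(j)}))^T\tilde x_0,$$ where all linear predictors $x_i^Tb_k^{(j)}$ lie in $N$ (which is automatic when the natural parameter space is $\mathbb R$). Let $A_k=\{t\,b_k^{(j)}+(1-t)\,b_k^{(j+1)}:t\in(0,1),\ j=1,2,\dots\}$ for $1\le k\le m$, and $$\rho=\max_{1\le k\le m}\ \sup_{\xi\in A_k}\|\mathcal I(\xi)\|_2\in[0,\infty],$$ with $\|\cdot\|_2$ the spectral norm. **Theorem.** Suppose $\rho<2-\mathcal L_\Theta$. Then $F(B^{(j)})$ is nonincreasing in $j\ge 1$ and $$F(B^{(j)})-F(B^{(j+1)})\ \ge\ \frac{2-\mathcal L_\Theta-\rho}{2}\,\|B^{(j)}-B^{(j+1)}\|_F^2,\qquad j=1,2,\dots$$ Moreover, let $B^*$ be any limit point of the sequence $(B^{(j)})$ whose linear predictors $x_i^Tb^*_k$ lie in $N$ (again automatic when the natural parameter space is $\mathbb R$), and suppose that $\Theta(\cdot;\lambda)$ is continuous at every singular value of $B^{*\circ}+X^{\circ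 T}Y-X^{\circ T}\mu(B^*)$. Then $B^*$ satisfies $$B^{*\circ}=\Theta^\sigma\bigl(B^{*\circ}+X^{\circ T}Y-X^{\circ T}\mu(B^*);\lambda\bigr),\qquad 0=(Y-\mu(B^*))^T\tilde x_0.$$ -/

import Mathlib

open MeasureTheory Set Filter Topology
open scoped ENNReal

namespace MatrixTISP

/-! ### Threshold functions and the penalties built from them -/

/-- A threshold function `Θ(t; λ)`, `t ∈ ℝ`, `0 ≤ λ < ∞`: odd, nondecreasing and unbounded in `t`,
with `0 ≤ Θ(t; λ) ≤ t` for `t ≥ 0`. -/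
structure IsThreshold (Θ : ℝ → ℝ → ℝ) : Prop where
  odd : ∀ lam, 0 ≤ lam → ∀ t, Θ (-t) lam = -Θ t lam
  mono : ∀ lam, 0 ≤ lam → ∀ t t', t ≤ t' → Θ t lam ≤ Θ t' lam
  tendsto : ∀ lam, 0 ≤ lam → Tendsto (fun t => Θ t lam) atTop atTop
  bounds : ∀ lam, 0 ≤ lam → ∀ t, 0 ≤ t → 0 ≤ Θ t lam ∧ Θ t lam ≤ t

/-- The generalized inverse `Θ⁻¹(u; λ) = sup {t : Θ(t; λ) ≤ u}`. For a threshold function and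
`u ≥ 0` the set is nonempty and bounded above. -/
noncomputable def thresholdInv (Θ : ℝ → ℝ → ℝ) (lam u : ℝ) : ℝ :=
  sSup {t : ℝ | Θ t lam ≤ u}

/-- `L ∈ [0, 1]` is an admissible constant `𝓛_Θ`: `dΘ⁻¹(u; λ)/du ≥ 1 - L` for almost every `u > 0`,
with `L` independent of `λ`. (`Θ⁻¹(·; λ)` is monotone, hence differentiable almost everywhere.) -/
structure IsCurvatureConst (Θ : ℝ → ℝ → ℝ) (L : ℝ) : Prop where
  nonneg : 0 ≤ L
  le_one : L ≤ 1
  deriv_ge : ∀ lam, 0 ≤ lam →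
    ∀ᵐ u ∂(volume.restrict (Ioi (0 : ℝ))), 1 - L ≤ deriv (thresholdInv Θ lam) u

/-- `P` is a penalty constructed from `Θ`:
`P(θ; λ) - P(0; λ) = ∫₀^{|θ|} (Θ⁻¹(u; λ) - u) du + q(θ; λ)` for some `q ≥ 0` that vanishes on the
range of `Θ(·; λ)`. -/
def IsPenaltyOf (Θ P : ℝ → ℝ → ℝ) : Prop :=
  ∃ q : ℝ → ℝ → ℝ, ∀ lam, 0 ≤ lam →
    (∀ θ, 0 ≤ q θ lam) ∧ (∀ t, q (Θ t lam) lam = 0) ∧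
    ∀ θ, P θ lam - P 0 lam = (∫ u in (0 : ℝ)..|θ|, (thresholdInv Θ lam u - u)) + q θ lam

/-! ### Singular value decomposition and matrix thresholding -/

/-- The `s`-th largest singular value of `M` (zero-indexed; it is `0` for `s ≥ min p m`). -/
noncomputable def singVal {p m : ℕ} (M : Matrix (Fin p) (Fin m) ℝ) (s : ℕ) : ℝ :=
  (Matrix.toEuclideanLin M).singularValues s

/-- `M = U diag(σ₁, …, σ_{p ∧ m}) Vᵀ` is a (thin) singular value decomposition of `M`. -/
structure IsSVD {p m : ℕ} (M : Matrix (Fin p) (Fin m) ℝ)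
    (U : Matrix (Fin p) (Fin (min p m)) ℝ) (V : Matrix (Fin m) (Fin (min p m)) ℝ) : Prop where
  orthonormal_left : U.transpose * U = 1
  orthonormal_right : V.transpose * V = 1
  eq : M = U * Matrix.diagonal (fun s : Fin (min p m) => singVal M s) * V.transpose

theorem exists_isSVD {p m : ℕ} (M : Matrix (Fin p) (Fin m) ℝ) :
    ∃ UV : Matrix (Fin p) (Fin (min p m)) ℝ × Matrix (Fin m) (Fin (min p m)) ℝ,
      IsSVD M UV.1 UV.2 := by
  classical
  set T := Matrix.toEuclideanLin M with hTdef
  have hm : Module.finrank ℝ (EuclideanSpace ℝ (Fin m)) = m := by simp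
  have hp : Module.finrank ℝ (EuclideanSpace ℝ (Fin p)) = p := by simp
  set w := T.isSymmetric_adjoint_comp_self.eigenvectorBasis hm with hw
  have hTT : ∀ i, (LinearMap.adjoint T) (T (w i)) = (T.singularValues i ^ 2) • w i := by
    intro i
    have h := T.isSymmetric_adjoint_comp_self.apply_eigenvectorBasis hm i
    rw [T.sq_singularValues_fin hm i]
    exact h
  have hinner : ∀ i j, inner ℝ (T (w i)) (T (w j)) = if i = j then T.singularValues j ^ 2 else 0 := by
    intro i j
    rw [← LinearMap.adjoint_inner_right, hTT, inner_smul_right,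
      orthonormal_iff_ite.mp w.orthonormal i j]
    simp
  have hzero : ∀ i : Fin m, T.singularValues i = 0 → T (w i) = 0 := by
    intro i hi
    have h := hinner i i
    simpa [hi] using h
  have hlt : ∀ i : ℕ, 0 < T.singularValues i → i < p ∧ i < m := by
    intro i hi
    have h := T.singularValues_pos_iff_lt_finrank_range.mp hi
    constructor
    · exact lt_of_lt_of_le h ((Submodule.finrank_le _).trans hp.le)
    · exact lt_of_lt_of_le h ((LinearMap.finrank_range_le T).trans hm.le)
  let v : Fin p → EuclideanSpace ℝ (Fin p) := fun i =>
    if h : (i : ℕ) < m then (T.singularValues i)⁻¹ • T (w ⟨i, h⟩) else 0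
  have hv : Orthonormal ℝ (({i : Fin p | 0 < T.singularValues i}).domRestrict v) := by
    rw [orthonormal_iff_ite]
    rintro ⟨i, hi⟩ ⟨j, hj⟩
    have hi' : 0 < T.singularValues (i : ℕ) := hi
    have hj' : 0 < T.singularValues (j : ℕ) := hj
    have h1 := (hlt _ hi').2
    have h2 := (hlt _ hj').2
    simp only [Set.domRestrict_apply, v, h1, h2, dif_pos, inner_smul_left, inner_smul_right, hinner,
      Subtype.mk.injEq, Fin.ext_iff]
    split_ifs with h
    · rw [h]
      simp only [conj_trivial]
      field_simp
    · simp
  obtain ⟨u, hu⟩ := hv.exists_orthonormalBasis_extension_of_card_eq (by simp)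
  have hTw : ∀ (i : ℕ) (h1 : i < p) (h2 : i < m),
      T (w ⟨i, h2⟩) = T.singularValues i • u ⟨i, h1⟩ := by
    intro i h1 h2
    rcases (T.singularValues_nonneg i).eq_or_lt with h | h
    · rw [← h, zero_smul]
      exact hzero ⟨i, h2⟩ h.symm
    · rw [hu ⟨i, h1⟩ h]
      simp only [v, h2, dif_pos, smul_smul]
      rw [mul_inv_cancel₀ h.ne', one_smul]
  let c₁ : Fin (min p m) → Fin p := Fin.castLE (min_le_left p m)
  let c₂ : Fin (min p m) → Fin m := Fin.castLE (min_le_right p m)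
  have hc₁ : ∀ s t, c₁ s = c₁ t ↔ s = t := fun s t => by simp [c₁, Fin.ext_iff]
  have hc₂ : ∀ s t, c₂ s = c₂ t ↔ s = t := fun s t => by simp [c₂, Fin.ext_iff]
  refine ⟨(Matrix.of fun a s => u (c₁ s) a, Matrix.of fun a s => w (c₂ s) a), ?_, ?_, ?_⟩
  · ext s t
    have h := orthonormal_iff_ite.mp u.orthonormal (c₁ s) (c₁ t)
    simp only [PiLp.inner_apply, hc₁] at h
    simp only [Matrix.mul_apply, Matrix.transpose_apply, Matrix.of_apply, Matrix.one_apply, ← h]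
    exact Finset.sum_congr rfl fun a _ => by simp [mul_comm]
  · ext s t
    have h := orthonormal_iff_ite.mp w.orthonormal (c₂ s) (c₂ t)
    simp only [PiLp.inner_apply, hc₂] at h
    simp only [Matrix.mul_apply, Matrix.transpose_apply, Matrix.of_apply, Matrix.one_apply, ← h]
    exact Finset.sum_congr rfl fun a _ => by simp [mul_comm]
  · ext a b
    have h1 : M a b = (T (EuclideanSpace.single b 1)) a := by
      simp [hTdef, Matrix.toLpLin_apply]
    rw [h1]
    conv_lhs => rw [← w.sum_repr' (EuclideanSpace.single b 1)]
    simp only [map_sum, map_smul, Matrix.mul_apply, Matrix.transpose_apply,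
      Matrix.of_apply, WithLp.ofLp_sum, WithLp.ofLp_smul, Finset.sum_apply, Pi.smul_apply,
      smul_eq_mul]
    symm
    refine Finset.sum_of_injOn c₂ (fun s _ t _ h => (hc₂ s t).mp h) (by simp) ?_ ?_
    · intro i _ hi
      have hip : p ≤ (i : ℕ) := by
        by_contra hlt'
        push Not at hlt'
        exact hi ⟨⟨i, lt_min hlt' i.2⟩, by simp, by simp [c₂]⟩
      have : T.singularValues i = 0 := by
        rcases (T.singularValues_nonneg i).eq_or_lt with h | h
        · exact h.symm
        · exact absurd (hlt _ h).1 (by omega)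
      rw [hzero i this]
      simp
    · intro s _
      have h := hTw s (lt_of_lt_of_le s.2 (min_le_left p m)) (lt_of_lt_of_le s.2 (min_le_right p m))
      have h' : T (w (c₂ s)) = T.singularValues s • u (c₁ s) := h
      have hin : inner ℝ (w (c₂ s)) (EuclideanSpace.single b (1 : ℝ)) = w (c₂ s) b := by
        simp [EuclideanSpace.inner_single_right]
      rw [h', hin, Finset.sum_eq_single s]
      · simp [singVal, ← hTdef]
        ring
      · intro t _ hts
        simp [Matrix.diagonal_apply_ne _ hts]
      · simp

/-- The matrix version of a threshold function: `Θ^σ(M; λ) = U diag(Θ(σ_s; λ)) Vᵀ`, where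
`M = U diag(σ_s) Vᵀ` is a singular value decomposition. -/
noncomputable def matrixThreshold (Θ : ℝ → ℝ → ℝ) (lam : ℝ) {p m : ℕ}
    (M : Matrix (Fin p) (Fin m) ℝ) : Matrix (Fin p) (Fin m) ℝ :=
  (exists_isSVD M).choose.1 *
    Matrix.diagonal (fun s : Fin (min p m) => Θ (singVal M s) lam) *
    (exists_isSVD M).choose.2.transpose

/-! ### Natural exponential families and vector GLMs with canonical link -/

/-- A natural exponential family on `ℝ`, given by its dominating measure `base` and the function `c`
in the densities `f(y; θ) = exp (y θ - b(θ) + c(y))`. -/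
structure NatExpFamily where
  base : Measure ℝ
  c : ℝ → ℝ
  base_ne_zero : base ≠ 0
  measurable_c : Measurable c

namespace NatExpFamily

/-- The interior of the natural parameter space `{θ : ∫ exp (y θ + c(y)) dy < ∞}`. -/
def natParam (fam : NatExpFamily) : Set ℝ :=
  interior {θ : ℝ | Integrable (fun y => Real.exp (y * θ + fam.c y)) fam.base}

/-- The cumulant function `b(θ)`, i.e. the normalization that makes `f(·; θ)` a probability
density. -/
noncomputable def b (fam : NatExpFamily) (θ : ℝ) : ℝ :=
  Real.log (∫ y, Real.exp (y * θ + fam.c y) ∂fam.base)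

/-- The density `f(y; θ) = exp (y θ - b(θ) + c(y))`. -/
noncomputable def density (fam : NatExpFamily) (y θ : ℝ) : ℝ :=
  Real.exp (y * θ - fam.b θ + fam.c y)

end NatExpFamily

section GLM

variable {n p m : ℕ}

/-- `B°`: the coefficient matrix without its first row (the intercepts). -/
def noIntercept (B : Matrix (Fin (p + 1)) (Fin m) ℝ) : Matrix (Fin p) (Fin m) ℝ :=
  B.submatrix Fin.succ id

/-- `X°`: the model matrix without its first column. -/
def noFirstCol (X : Matrix (Fin n) (Fin (p + 1)) ℝ) : Matrix (Fin n) (Fin p) ℝ :=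
  X.submatrix id Fin.succ

/-- The mean vector `μ(β) = [g⁻¹(x_iᵀ β)]_i`, with `g⁻¹ = b'` (canonical link). -/
noncomputable def meanVec (fam : NatExpFamily) (X : Matrix (Fin n) (Fin (p + 1)) ℝ)
    (β : Fin (p + 1) → ℝ) : Fin n → ℝ :=
  fun i => deriv fam.b (X.mulVec β i)

/-- The mean matrix `μ(B) = [μ(b_1), …, μ(b_m)]`. -/
noncomputable def meanMatrix (fam : NatExpFamily) (X : Matrix (Fin n) (Fin (p + 1)) ℝ)
    (B : Matrix (Fin (p + 1)) (Fin m) ℝ) : Matrix (Fin n) (Fin m) ℝ :=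
  Matrix.of fun i k => meanVec fam X (fun r => B r k) i

/-- The information matrix `𝓘(β) = Xᵀ diag{b''(x_iᵀ β)} X`. -/
noncomputable def infoMatrix (fam : NatExpFamily) (X : Matrix (Fin n) (Fin (p + 1)) ℝ)
    (β : Fin (p + 1) → ℝ) : Matrix (Fin (p + 1)) (Fin (p + 1)) ℝ :=
  X.transpose * Matrix.diagonal (fun i => iteratedDeriv 2 fam.b (X.mulVec β i)) * X

/-- The objective `F(B) = -∑_k ∑_i log f(y_{ik}; x_iᵀ b_k) + ∑_{s ≤ p ∧ m} P(σ_s(B°); λ)`. -/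
noncomputable def objective (fam : NatExpFamily) (P : ℝ → ℝ → ℝ) (lam : ℝ)
    (X : Matrix (Fin n) (Fin (p + 1)) ℝ) (Y : Matrix (Fin n) (Fin m) ℝ)
    (B : Matrix (Fin (p + 1)) (Fin m) ℝ) : ℝ :=
  -(∑ k : Fin m, ∑ i : Fin n, Real.log (fam.density (Y i k) (X.mulVec (fun r => B r k) i)))
    + ∑ s : Fin (min p m), P (singVal (noIntercept B) s) lam

/-- The matrix `B° + X°ᵀ Y - X°ᵀ μ(B)` to which `Θ^σ` is applied. -/
noncomputable def tispArg (fam : NatExpFamily) (X : Matrix (Fin n) (Fin (p + 1)) ℝ)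
    (Y : Matrix (Fin n) (Fin m) ℝ) (B : Matrix (Fin (p + 1)) (Fin m) ℝ) :
    Matrix (Fin p) (Fin m) ℝ :=
  noIntercept B + (noFirstCol X).transpose * Y - (noFirstCol X).transpose * meanMatrix fam X B

/-- The vector `(Y - μ(B))ᵀ x̃₀`, where `x̃₀` is the first column of `X`. -/
noncomputable def interceptScore (fam : NatExpFamily) (X : Matrix (Fin n) (Fin (p + 1)) ℝ)
    (Y : Matrix (Fin n) (Fin m) ℝ) (B : Matrix (Fin (p + 1)) (Fin m) ℝ) : Fin m → ℝ :=
  (Y - meanMatrix fam X B).transpose.mulVec (fun i => X i 0)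

/-- `B^(0), B^(1), …` is a run of the matrix-TISP iteration. -/
def IsMatrixTISP (Θ : ℝ → ℝ → ℝ) (lam : ℝ) (fam : NatExpFamily)
    (X : Matrix (Fin n) (Fin (p + 1)) ℝ) (Y : Matrix (Fin n) (Fin m) ℝ)
    (B : ℕ → Matrix (Fin (p + 1)) (Fin m) ℝ) : Prop :=
  ∀ j : ℕ,
    noIntercept (B (j + 1)) = matrixThreshold Θ lam (tispArg fam X Y (B j)) ∧
    B (j + 1) 0 = B j 0 + interceptScore fam X Y (B j)

/-- The set `A_k = {t b_k^(j) + (1 - t) b_k^(j+1) : t ∈ (0, 1), j = 1, 2, …}`. -/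
def segmentSet (B : ℕ → Matrix (Fin (p + 1)) (Fin m) ℝ) (k : Fin m) : Set (Fin (p + 1) → ℝ) :=
  {ξ | ∃ t ∈ Ioo (0 : ℝ) 1, ∃ j : ℕ, 1 ≤ j ∧
    ξ = t • (fun r => B j r k) + (1 - t) • (fun r => B (j + 1) r k)}

/-- The spectral norm `‖A‖₂` of a square matrix. -/
noncomputable def specNorm {d : ℕ} (A : Matrix (Fin d) (Fin d) ℝ) : ℝ :=
  ‖Matrix.toEuclideanCLM (𝕜 := ℝ) A‖

open scoped Matrix.Norms.Frobenius in
/-- The Frobenius norm `‖A‖_F`. -/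
noncomputable def frobNorm {r k : ℕ} (A : Matrix (Fin r) (Fin k) ℝ) : ℝ := ‖A‖

/-- `ρ = max_k sup_{ξ ∈ A_k} ‖𝓘(ξ)‖₂`, an element of `[0, ∞]`. -/
noncomputable def rho (fam : NatExpFamily) (X : Matrix (Fin n) (Fin (p + 1)) ℝ)
    (B : ℕ → Matrix (Fin (p + 1)) (Fin m) ℝ) : ℝ≥0∞ :=
  ⨆ k : Fin m, ⨆ ξ ∈ segmentSet B k, ENNReal.ofReal (specNorm (infoMatrix fam X ξ))

end GLM

end MatrixTISP

namespace MatrixTISP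

/-! ### The scalar threshold and its penalty -/

section Scalar

variable {Θ P : ℝ → ℝ → ℝ} {L lam : ℝ}

/-! The iteration is a majorization scheme: each step compares a quadratic upper bound on the loss
with a quadratic lower bound on the penalty gap. Write `B`, `C` for consecutive iterates, `G = X°ᵀ(Y
- μ(B))`, `A = B° + G`, `E = C° - B°`. Taylor's formula bounds the loss at `C` by its linearization
at `B` plus `ρ/2 ‖C - B‖²` (`negLogLik_le`). Since `C° = Θ^σ(A)`, the penalty falls by at least `(2
- L)/2 ‖E‖² - ⟨G, E⟩` (`matrixThreshold_variational`). The linear terms cancel, leaving the claimed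
decrease (`objective_sub_ge`).

The penalty bound is first scalar: `Θ⁻¹` grows at rate at least `1 - L`, so integrating an affine
comparison function from `Θ(t)` gives `IsPenaltyOf.sub_ge`. It lifts to matrices because `A - (1 -
L)C°` has the singular vectors of `A` and nonnegative, nonincreasing diagonal entries, so von
Neumann's trace inequality reduces inner products to singular values.

Near a limit point `F` is bounded below, so the summable decrease forces increments to zero and
`B^(j)`, `B^(j+1)` share the limit. The fixed-point equations follow by continuity; for `Θ^σ` this
rests on compactness of the singular vectors and independence of the chosen decomposition
(`continuousAt_matrixThreshold`). -/

theorem IsThreshold.bddAbove (hΘ : IsThreshold Θ) (hlam : 0 ≤ lam) (u : ℝ) :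
    BddAbove {t : ℝ | Θ t lam ≤ u} := by
  obtain ⟨T, hT⟩ := ((hΘ.tendsto lam hlam).eventually_gt_atTop u).exists
  refine ⟨T, fun t ht => ?_⟩
  by_contra! h
  exact absurd (hΘ.mono lam hlam T t h.le) (not_le.mpr (lt_of_le_of_lt ht hT))

theorem IsThreshold.nonempty (hΘ : IsThreshold Θ) (hlam : 0 ≤ lam) (u : ℝ) :
    {t : ℝ | Θ t lam ≤ u}.Nonempty := by
  obtain ⟨T, hT⟩ := ((hΘ.tendsto lam hlam).eventually_ge_atTop (-u)).exists
  exact ⟨-T, by rw [mem_ofPred_eq, hΘ.odd lam hlam]; linarith⟩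

theorem IsThreshold.le_thresholdInv (hΘ : IsThreshold Θ) (hlam : 0 ≤ lam) {t u : ℝ}
    (h : Θ t lam ≤ u) : t ≤ thresholdInv Θ lam u :=
  le_csSup (hΘ.bddAbove hlam u) h

theorem IsThreshold.thresholdInv_le (hΘ : IsThreshold Θ) (hlam : 0 ≤ lam) {t u : ℝ}
    (h : u < Θ t lam) : thresholdInv Θ lam u ≤ t := by
  refine csSup_le (hΘ.nonempty hlam u) fun s hs => ?_
  by_contra! hts
  exact absurd (hΘ.mono lam hlam t s hts.le) (not_le.mpr (lt_of_le_of_lt hs h))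

theorem IsThreshold.monotone_thresholdInv (hΘ : IsThreshold Θ) (hlam : 0 ≤ lam) :
    Monotone (thresholdInv Θ lam) := fun _ v huv =>
  csSup_le_csSup (hΘ.bddAbove hlam v) (hΘ.nonempty hlam _) fun _ ht => le_trans ht huv

theorem IsThreshold.self_le_thresholdInv (hΘ : IsThreshold Θ) (hlam : 0 ≤ lam) {u : ℝ}
    (hu : 0 ≤ u) : u ≤ thresholdInv Θ lam u :=
  hΘ.le_thresholdInv hlam (hΘ.bounds lam hlam u hu).2

theorem IsThreshold.map_zero (hΘ : IsThreshold Θ) (hlam : 0 ≤ lam) : Θ 0 lam = 0 :=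
  le_antisymm (hΘ.bounds lam hlam 0 le_rfl).2 (hΘ.bounds lam hlam 0 le_rfl).1

/-- A monotone function increases by at least the integral of its a.e. derivative; jumps of `Θ⁻¹`
only help. -/
theorem IsCurvatureConst.mul_sub_le (hL : IsCurvatureConst Θ L) (hΘ : IsThreshold Θ)
    (hlam : 0 ≤ lam) {u v : ℝ} (hu : 0 ≤ u) (huv : u ≤ v) :
    (1 - L) * (v - u) ≤ thresholdInv Θ lam v - thresholdInv Θ lam u := by
  have hmono : MonotoneOn (thresholdInv Θ lam) (uIcc u v) :=
    (hΘ.monotone_thresholdInv hlam).monotoneOn _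
  have h1 := hmono.intervalIntegral_deriv_mem_uIcc
  rw [uIcc_of_le (sub_nonneg.mpr (hΘ.monotone_thresholdInv hlam huv))] at h1
  have h2 : ∫ _ in u..v, (1 - L) ≤ ∫ x in u..v, deriv (thresholdInv Θ lam) x := by
    refine intervalIntegral.integral_mono_ae_restrict huv (by simp)
      hmono.intervalIntegrable_deriv ?_
    -- Dropping the left endpoint matters when `u = 0`, as the derivative bound concerns positive
    -- arguments only.
    rw [← restrict_Ioc_eq_restrict_Icc]
    exact ae_restrict_of_ae_restrict_of_subset (fun x hx => lt_of_le_of_lt hu hx.1)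
      (hL.deriv_ge lam hlam)
  rw [intervalIntegral.integral_const, smul_eq_mul, mul_comm] at h2
  exact h2.trans h1.2

/-- The affine function `u ↦ t + (1 - L) (u - Θ(t))` separates the values of `Θ⁻¹` to the left and
to the right of `Θ(t)`: left half. -/
theorem IsCurvatureConst.thresholdInv_le_of_lt (hL : IsCurvatureConst Θ L) (hΘ : IsThreshold Θ)
    (hlam : 0 ≤ lam) {t u : ℝ} (hu : 0 ≤ u) (h : u < Θ t lam) :
    thresholdInv Θ lam u ≤ t + (1 - L) * (u - Θ t lam) := by
  -- `Θ⁻¹(Θ(t))` may exceed `t` when `Θ` has a plateau, so the growth bound is applied up to `Θ(t) -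
  -- δ`, where `Θ⁻¹ ≤ t`.
  refine le_of_forall_pos_le_add fun ε hε => ?_
  have hm1 := min_le_left ε (Θ t lam - u)
  have hm2 := min_le_right ε (Θ t lam - u)
  have hm0 : 0 < min ε (Θ t lam - u) := lt_min hε (by linarith)
  set δ := min ε (Θ t lam - u)
  have h1 := hL.mul_sub_le hΘ hlam hu (v := Θ t lam - δ) (by linarith)
  have h2 := hΘ.thresholdInv_le hlam (t := t) (u := Θ t lam - δ) (by linarith)
  nlinarith [hL.nonneg, hL.le_one]

/-- The right half of `thresholdInv_le_of_lt`. -/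
theorem IsCurvatureConst.le_thresholdInv_of_le (hL : IsCurvatureConst Θ L) (hΘ : IsThreshold Θ)
    (hlam : 0 ≤ lam) {t u : ℝ} (ht : 0 ≤ t) (h : Θ t lam ≤ u) :
    t + (1 - L) * (u - Θ t lam) ≤ thresholdInv Θ lam u := by
  have h1 := hL.mul_sub_le hΘ hlam (hΘ.bounds lam hlam t ht).1 h
  have h2 := hΘ.le_thresholdInv hlam (le_refl (Θ t lam))
  linarith

/-- `(1 - L) Θ` is `1`-Lipschitz from above on the nonnegative half-line. -/
theorem IsCurvatureConst.mul_threshold_sub_le (hL : IsCurvatureConst Θ L) (hΘ : IsThreshold Θ)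
    (hlam : 0 ≤ lam) {t t' : ℝ} (ht : 0 ≤ t) (htt : t ≤ t') :
    (1 - L) * (Θ t' lam - Θ t lam) ≤ t' - t := by
  rcases (hΘ.mono lam hlam t t' htt).eq_or_lt with h | h
  · rw [h]; linarith
  · have h1 := hL.thresholdInv_le_of_lt hΘ hlam (hΘ.bounds lam hlam t ht).1 h
    have h2 := hΘ.le_thresholdInv hlam (le_refl (Θ t lam))
    linarith

theorem IsThreshold.intervalIntegrable (hΘ : IsThreshold Θ) (hlam : 0 ≤ lam) (a b : ℝ) :
    IntervalIntegrable (fun u => thresholdInv Θ lam u - u) volume a b :=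
  (hΘ.monotone_thresholdInv hlam).intervalIntegrable.sub
    (continuous_id.intervalIntegrable a b)

theorem integral_affine (a b c d : ℝ) :
    ∫ u in a..b, (c - d * u) = c * (b - a) - d / 2 * (b ^ 2 - a ^ 2) := by
  have hi : IntervalIntegrable (fun u : ℝ => d * u) volume a b :=
    (continuous_const.mul continuous_id).intervalIntegrable a b
  rw [intervalIntegral.integral_sub (by simp) hi]
  have h1 : ∫ u in a..b, d * u = d * ∫ u in a..b, u := intervalIntegral.integral_const_mul d _
  rw [h1, integral_id, intervalIntegral.integral_const, smul_eq_mul]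
  ring

/-- The left side is the integral of the separating affine function minus `u`. For `v < Θ(t)` the
comparison and the orientation of the integral both reverse. -/
theorem IsCurvatureConst.integral_ge (hL : IsCurvatureConst Θ L) (hΘ : IsThreshold Θ)
    (hlam : 0 ≤ lam) {t v : ℝ} (ht : 0 ≤ t) (hv : 0 ≤ v) :
    (t - (1 - L) * Θ t lam) * (v - Θ t lam) - L / 2 * (v ^ 2 - Θ t lam ^ 2) ≤
      ∫ u in (Θ t lam)..v, (thresholdInv Θ lam u - u) := by
  have hi : ∀ a b : ℝ, IntervalIntegrable
      (fun u => (t - (1 - L) * Θ t lam) - L * u) volume a b := fun a b =>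
    (continuous_const.sub (continuous_const.mul continuous_id)).intervalIntegrable a b
  rcases le_total (Θ t lam) v with h | h
  · rw [← integral_affine]
    refine intervalIntegral.integral_mono_on h (hi _ _) (hΘ.intervalIntegrable hlam _ _)
      fun u hu => ?_
    have := hL.le_thresholdInv_of_le hΘ hlam ht hu.1
    linarith
  · have h2 : ∫ u in v..(Θ t lam), (thresholdInv Θ lam u - u) ≤
        ∫ u in v..(Θ t lam), ((t - (1 - L) * Θ t lam) - L * u) := by
      -- The upper comparison can fail at `u = Θ(t)` itself, hence the open interval.
      refine intervalIntegral.integral_mono_on_of_le_Ioo h (hΘ.intervalIntegrable hlam _ _)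
        (hi _ _) fun u hu => ?_
      have := hL.thresholdInv_le_of_lt hΘ hlam (hv.trans hu.1.le) hu.2
      linarith
    rw [integral_affine] at h2
    rw [intervalIntegral.integral_symm]
    linarith

/-- The threshold minimizes the scalar penalized problem, with a quadratic margin. -/
theorem IsPenaltyOf.sub_ge (hP : IsPenaltyOf Θ P) (hL : IsCurvatureConst Θ L)
    (hΘ : IsThreshold Θ) (hlam : 0 ≤ lam) {t v : ℝ} (ht : 0 ≤ t) (hv : 0 ≤ v) :
    (t - (1 - L) * Θ t lam) * (v - Θ t lam) - L / 2 * (v ^ 2 - Θ t lam ^ 2) ≤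
      P v lam - P (Θ t lam) lam := by
  obtain ⟨q, hq⟩ := hP
  obtain ⟨hq0, hqΘ, hPq⟩ := hq lam hlam
  have h1 := hPq v
  have h2 := hPq (Θ t lam)
  rw [abs_of_nonneg hv] at h1
  rw [abs_of_nonneg (hΘ.bounds lam hlam t ht).1, hqΘ] at h2
  have h3 := intervalIntegral.integral_interval_sub_left
    (hΘ.intervalIntegrable hlam 0 v) (hΘ.intervalIntegrable hlam 0 (Θ t lam))
  have h4 := hL.integral_ge hΘ hlam ht hv
  linarith [hq0 v]

/-- The integrand is nonnegative because `Θ(u) ≤ u`. This keeps the objective bounded below near a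
limit point. -/
theorem IsPenaltyOf.zero_le (hP : IsPenaltyOf Θ P) (hΘ : IsThreshold Θ) (hlam : 0 ≤ lam) (v : ℝ) :
    P 0 lam ≤ P v lam := by
  obtain ⟨q, hq⟩ := hP
  obtain ⟨hq0, -, hPq⟩ := hq lam hlam
  have h1 : 0 ≤ ∫ u in (0 : ℝ)..|v|, (thresholdInv Θ lam u - u) :=
    intervalIntegral.integral_nonneg (abs_nonneg v) fun u hu =>
      sub_nonneg.mpr (hΘ.self_le_thresholdInv hlam hu.1)
  linarith [hPq v, hq0 v]

end Scalar

end MatrixTISP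

namespace MatrixTISP

/-! ### Summation by parts and doubly substochastic matrices -/

/-- Abel summation. The lower bound `c` is what closes the induction: the last value of `d` serves
as `c` for the shorter sum. -/
theorem mul_sum_le_sum_mul_of_antitone : ∀ {r : ℕ} {d w : Fin r → ℝ} {c : ℝ},
    Antitone d → (∀ s, c ≤ d s) →
    (∀ k : ℕ, 0 ≤ ∑ s : Fin r, if (s : ℕ) < k then w s else 0) →
    c * ∑ s, w s ≤ ∑ s, d s * w s
  | 0, _, _, _, _, _, _ => by simp
  | r + 1, d, w, c, hd, hc, hw => by
    have ih := mul_sum_le_sum_mul_of_antitone (r := r) (d := fun s => d s.castSucc)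
      (w := fun s => w s.castSucc) (c := d (Fin.last r))
      (fun s t hst => hd (Fin.castSucc_le_castSucc_iff.mpr hst)) (fun s => hd (Fin.le_last _))
      (fun k => by
        -- Cutting at `r` removes the last summand from the partial sum.
        have h := hw (min k r)
        rw [Fin.sum_univ_castSucc] at h
        simpa using h)
    have htot := hw (r + 1)
    simp only [Fin.is_lt, if_true] at htot
    rw [Fin.sum_univ_castSucc] at htot
    rw [Fin.sum_univ_castSucc, Fin.sum_univ_castSucc]
    nlinarith [mul_le_mul_of_nonneg_right (hc (Fin.last r)) htot]

theorem sum_mul_nonneg_of_antitone {r : ℕ} {d w : Fin r → ℝ} (hd : Antitone d)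
    (h0 : ∀ s, 0 ≤ d s) (hw : ∀ k : ℕ, 0 ≤ ∑ s : Fin r, if (s : ℕ) < k then w s else 0) :
    0 ≤ ∑ s, d s * w s := by
  simpa using mul_sum_le_sum_mul_of_antitone hd h0 hw

/-- The rearrangement inequality for a doubly substochastic matrix. -/
theorem sum_mul_le_of_substochastic {r : ℕ} {x d : Fin r → ℝ} {S : Fin r → Fin r → ℝ}
    (hx : Antitone x) (hx0 : ∀ s, 0 ≤ x s) (hd : Antitone d) (hd0 : ∀ s, 0 ≤ d s)
    (hS : ∀ s t, 0 ≤ S s t) (hrow : ∀ s, ∑ t, S s t ≤ 1) (hcol : ∀ t, ∑ s, S s t ≤ 1) :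
    ∑ s, ∑ t, x s * d t * S s t ≤ ∑ s, x s * d s := by
  -- A corner of `S` with `l` rows and `k` columns sums to at most `min l k`: by rows if `l ≤ k`, by
  -- columns otherwise. Abel summation over rows with weights `x`, then over columns with weights
  -- `d`, gives the claim.
  have hcorner : ∀ l k : ℕ, 0 ≤ ∑ s : Fin r, if (s : ℕ) < l then
      ((if (s : ℕ) < k then 1 else 0) - ∑ t : Fin r, if (t : ℕ) < k then S s t else 0) else 0 := by
    intro l k
    rcases le_total l k with hlk | hkl
    · refine Finset.sum_nonneg fun s _ => ?_
      split_ifs with h1 h2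
      · have : (∑ t : Fin r, if (t : ℕ) < k then S s t else 0) ≤ ∑ t, S s t :=
          Finset.sum_le_sum fun t _ => by split_ifs <;> simp [hS]
        linarith [hrow s]
      · omega
      · rfl
    · have h1 : (∑ s : Fin r, ∑ t : Fin r, if (s : ℕ) < l then
          (if (t : ℕ) < k then S s t else 0) else 0) ≤
          ∑ t : Fin r, if (t : ℕ) < k then 1 else 0 := by
        rw [Finset.sum_comm]
        refine Finset.sum_le_sum fun t _ => ?_
        split_ifs with h
        · refine le_trans (Finset.sum_le_sum fun s _ => ?_) (hcol t)
          split_ifs <;> simp [hS]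
        · simp
      have h2 : (∑ s : Fin r, if (s : ℕ) < l then
          ((if (s : ℕ) < k then (1 : ℝ) else 0) -
            ∑ t : Fin r, if (t : ℕ) < k then S s t else 0) else 0) =
          (∑ t : Fin r, if (t : ℕ) < k then 1 else 0) - (∑ s : Fin r, ∑ t : Fin r,
            if (s : ℕ) < l then (if (t : ℕ) < k then S s t else 0) else 0) := by
        rw [← Finset.sum_sub_distrib]
        refine Finset.sum_congr rfl fun s _ => ?_
        by_cases h : (s : ℕ) < l
        · simp [h]
        · simp [h, show ¬ (s : ℕ) < k by omega]
      rw [h2]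
      linarith
  have hpart : ∀ k : ℕ, 0 ≤ ∑ t : Fin r, if (t : ℕ) < k then
      (x t - ∑ s, x s * S s t) else 0 := by
    intro k
    have h := sum_mul_nonneg_of_antitone hx hx0 fun l => hcorner l k
    have h2 : (∑ t : Fin r, if (t : ℕ) < k then (x t - ∑ s, x s * S s t) else 0) =
        ∑ s, x s * ((if (s : ℕ) < k then 1 else 0) -
          ∑ t : Fin r, if (t : ℕ) < k then S s t else 0) := by
      have h3 : (∑ t : Fin r, if (t : ℕ) < k then (x t - ∑ s, x s * S s t) else 0) =
          (∑ t : Fin r, if (t : ℕ) < k then x t else 0) -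
            ∑ t : Fin r, ∑ s, if (t : ℕ) < k then x s * S s t else 0 := by
        rw [← Finset.sum_sub_distrib]
        refine Finset.sum_congr rfl fun t _ => ?_
        split_ifs <;> simp
      rw [h3, Finset.sum_comm, ← Finset.sum_sub_distrib]
      refine Finset.sum_congr rfl fun s _ => ?_
      rw [mul_sub, Finset.mul_sum]
      simp only [mul_ite, mul_one, mul_zero]
    rw [h2]
    exact h
  have h := sum_mul_nonneg_of_antitone hd hd0 hpart
  have h2 : ∑ t, d t * (x t - ∑ s, x s * S s t) =
      ∑ s, x s * d s - ∑ s, ∑ t, x s * d t * S s t := by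
    rw [Finset.sum_comm (f := fun s t => x s * d t * S s t), ← Finset.sum_sub_distrib]
    refine Finset.sum_congr rfl fun t _ => ?_
    rw [mul_sub, Finset.mul_sum]
    congr 1
    · ring
    · exact Finset.sum_congr rfl fun s _ => by ring
  rw [h2] at h
  linarith

/-! ### Von Neumann's trace inequality -/

section Trace

open Matrix

variable {p m r : ℕ}

theorem frobNorm_sq (A : Matrix (Fin p) (Fin m) ℝ) :
    frobNorm A ^ 2 = ∑ i, ∑ j, A i j ^ 2 := by
  rw [frobNorm, Matrix.frobenius_norm_def, ← Real.sqrt_eq_rpow, Real.sq_sqrt (by positivity)]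
  simp

theorem trace_transpose_mul_eq_sum (A B : Matrix (Fin p) (Fin m) ℝ) :
    (Aᵀ * B).trace = ∑ i, ∑ j, A i j * B i j := by
  rw [Finset.sum_comm]
  simp [Matrix.trace, Matrix.mul_apply]

theorem frobNorm_sq_eq_trace (A : Matrix (Fin p) (Fin m) ℝ) :
    frobNorm A ^ 2 = (Aᵀ * A).trace := by
  rw [frobNorm_sq, trace_transpose_mul_eq_sum]
  simp only [sq]

/-- Bessel's inequality for the columns of a matrix with orthonormal columns. -/
theorem sum_sq_transpose_mul_le_one {U W : Matrix (Fin p) (Fin r) ℝ} (hU : Uᵀ * U = 1)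
    (hW : Wᵀ * W = 1) (s : Fin r) : ∑ t, (Uᵀ * W) s t ^ 2 ≤ 1 := by
  -- The Gram matrix of the residuals of the columns of `U` after projection onto the span of `W`;
  -- its diagonal is nonnegative.
  have h1 : (U - W * (Wᵀ * U))ᵀ * (U - W * (Wᵀ * U)) = 1 - (Uᵀ * W) * (Uᵀ * W)ᵀ := by
    have h2 : Wᵀ * (W * (Wᵀ * U)) = Wᵀ * U := by rw [← Matrix.mul_assoc, hW, Matrix.one_mul]
    simp only [transpose_sub, transpose_mul, transpose_transpose, Matrix.sub_mul, Matrix.mul_sub,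
      hU, Matrix.mul_assoc, h2]
    abel
  have h3 := congrFun (congrFun h1 s) s
  rw [Matrix.sub_apply, Matrix.one_apply_eq, Matrix.mul_apply, Matrix.mul_apply] at h3
  have h4 : 0 ≤ ∑ j, (U - W * (Wᵀ * U))ᵀ s j * (U - W * (Wᵀ * U)) j s :=
    Finset.sum_nonneg fun j _ => mul_self_nonneg ((U - W * (Wᵀ * U)) j s)
  have h5 : ∑ t, (Uᵀ * W) s t ^ 2 = ∑ j, (Uᵀ * W) s j * (Uᵀ * W)ᵀ j s :=
    Finset.sum_congr rfl fun t _ => by rw [transpose_apply, sq]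
  rw [h5]
  linarith

theorem trace_transpose_mul_diagonal (U U' : Matrix (Fin p) (Fin r) ℝ)
    (V V' : Matrix (Fin m) (Fin r) ℝ) (x d : Fin r → ℝ) :
    ((U * diagonal x * Vᵀ)ᵀ * (U' * diagonal d * V'ᵀ)).trace =
      ∑ s, ∑ t, x s * d t * ((Uᵀ * U') s t * (Vᵀ * V') s t) := by
  have h1 : (U * diagonal x * Vᵀ)ᵀ * (U' * diagonal d * V'ᵀ) =
      V * (diagonal x * (Uᵀ * U') * diagonal d * V'ᵀ) := by
    simp only [transpose_mul, transpose_transpose, diagonal_transpose, Matrix.mul_assoc]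
  rw [h1, Matrix.trace_mul_comm, Matrix.mul_assoc, ← Matrix.transpose_transpose (V'ᵀ * V),
    transpose_mul, transpose_transpose]
  simp only [Matrix.trace, Matrix.diag_apply]
  refine Finset.sum_congr rfl fun s _ => ?_
  rw [Matrix.mul_apply]
  refine Finset.sum_congr rfl fun t _ => ?_
  rw [Matrix.mul_diagonal, Matrix.diagonal_mul, transpose_apply]
  ring

theorem trace_transpose_mul_diagonal_self {U : Matrix (Fin p) (Fin r) ℝ}
    {V : Matrix (Fin m) (Fin r) ℝ} (hU : Uᵀ * U = 1) (hV : Vᵀ * V = 1) (x d : Fin r → ℝ) :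
    ((U * diagonal x * Vᵀ)ᵀ * (U * diagonal d * Vᵀ)).trace = ∑ s, x s * d s := by
  rw [trace_transpose_mul_diagonal, hU, hV]
  simp [Matrix.one_apply]

/-- Von Neumann's trace inequality. -/
theorem trace_transpose_mul_diagonal_le {U U' : Matrix (Fin p) (Fin r) ℝ}
    {V V' : Matrix (Fin m) (Fin r) ℝ} (hU : Uᵀ * U = 1) (hV : Vᵀ * V = 1) (hU' : U'ᵀ * U' = 1)
    (hV' : V'ᵀ * V' = 1) {x d : Fin r → ℝ} (hx : Antitone x) (hx0 : ∀ s, 0 ≤ x s)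
    (hd : Antitone d) (hd0 : ∀ s, 0 ≤ d s) :
    ((U * diagonal x * Vᵀ)ᵀ * (U' * diagonal d * V'ᵀ)).trace ≤ ∑ s, x s * d s := by
  have hc : ∀ {q : ℕ} {W W' : Matrix (Fin q) (Fin r) ℝ}, Wᵀ * W = 1 → W'ᵀ * W' = 1 → ∀ t,
      ∑ s, (Wᵀ * W') s t ^ 2 ≤ 1 := fun {q W W'} hW hW' t => by
    have := sum_sq_transpose_mul_le_one hW' hW t
    rwa [← Matrix.transpose_transpose (W'ᵀ * W), transpose_mul, transpose_transpose] at this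
  rw [trace_transpose_mul_diagonal]
  -- By `ab ≤ (a² + b²)/2` the overlaps are dominated by a matrix that Bessel's inequality makes
  -- doubly substochastic.
  refine le_trans (Finset.sum_le_sum fun s _ => Finset.sum_le_sum fun t _ => ?_)
    (sum_mul_le_of_substochastic (S := fun s t => ((Uᵀ * U') s t ^ 2 + (Vᵀ * V') s t ^ 2) / 2)
      hx hx0 hd hd0 (fun s t => by positivity) (fun s => ?_) (fun t => ?_))
  · refine mul_le_mul_of_nonneg_left ?_ (mul_nonneg (hx0 s) (hd0 t))
    nlinarith [sq_nonneg ((Uᵀ * U') s t - (Vᵀ * V') s t)]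
  · rw [← Finset.sum_div, Finset.sum_add_distrib]
    linarith [sum_sq_transpose_mul_le_one hU hU' s, sum_sq_transpose_mul_le_one hV hV' s]
  · rw [← Finset.sum_div, Finset.sum_add_distrib]
    linarith [hc hU hU' t, hc hV hV' t]

end Trace

/-! ### Singular values and matrix thresholding -/

section Singular

open Matrix

variable {p m : ℕ}

theorem singVal_nonneg (M : Matrix (Fin p) (Fin m) ℝ) (s : ℕ) : 0 ≤ singVal M s :=
  LinearMap.singularValues_nonneg _ _

theorem antitone_singVal (M : Matrix (Fin p) (Fin m) ℝ) :
    Antitone fun s : Fin (min p m) => singVal M s := fun _ _ h =>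
  LinearMap.singularValues_antitone _ h

/-- Consecutive prefix sums differ by one entry. Prefix indicators are nonnegative and
nonincreasing, hence admissible weights in von Neumann's inequality. -/
theorem eq_of_sum_ite_eq {r : ℕ} {x y : Fin r → ℝ}
    (h : ∀ k : ℕ, (∑ s : Fin r, (if (s : ℕ) < k then (1 : ℝ) else 0) * x s) =
      ∑ s : Fin r, (if (s : ℕ) < k then (1 : ℝ) else 0) * y s) : x = y := by
  have key : ∀ (z : Fin r → ℝ) (s : Fin r), z s =
      (∑ t : Fin r, (if (t : ℕ) < (s : ℕ) + 1 then (1 : ℝ) else 0) * z t) -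
        ∑ t : Fin r, (if (t : ℕ) < s then (1 : ℝ) else 0) * z t := by
    intro z s
    rw [← Finset.sum_sub_distrib, Finset.sum_eq_single s]
    · simp
    · intro t _ hts
      have : (t : ℕ) ≠ s := fun h => hts (Fin.ext h)
      have h2 : ((t : ℕ) < (s : ℕ) + 1) = ((t : ℕ) < s) := propext (by omega)
      simp only [h2, sub_self]
    · simp
  funext s
  rw [key x, key y, h, h]

/-- Uniqueness of the singular values. -/
theorem singVal_eq_of_eq {M : Matrix (Fin p) (Fin m) ℝ}
    {U : Matrix (Fin p) (Fin (min p m)) ℝ} {V : Matrix (Fin m) (Fin (min p m)) ℝ}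
    {d : Fin (min p m) → ℝ} (hU : Uᵀ * U = 1) (hV : Vᵀ * V = 1) (hd : Antitone d)
    (hd0 : ∀ s, 0 ≤ d s) (hM : M = U * diagonal d * Vᵀ) :
    (fun s : Fin (min p m) => singVal M s) = d := by
  obtain ⟨⟨U', V'⟩, hU', hV', hM'⟩ := exists_isSVD M
  refine eq_of_sum_ite_eq fun k => ?_
  have he : Antitone fun s : Fin (min p m) => if (s : ℕ) < k then (1 : ℝ) else 0 := by
    intro s t hst
    have : (s : ℕ) ≤ t := hst
    dsimp only
    split_ifs <;> first | omega | norm_num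
  have he0 : ∀ s : Fin (min p m), (0 : ℝ) ≤ if (s : ℕ) < k then (1 : ℝ) else 0 := by
    intro s
    split_ifs <;> norm_num
  -- Each prefix sum is a trace against `M` in one decomposition; von Neumann bounds it by the
  -- prefix sum of the other.
  refine le_antisymm ?_ ?_
  · rw [← trace_transpose_mul_diagonal_self hU' hV', ← hM']
    conv_lhs => rw [hM]
    exact trace_transpose_mul_diagonal_le hU' hV' hU hV he he0 hd hd0
  · rw [← trace_transpose_mul_diagonal_self hU hV, ← hM]
    conv_lhs => rw [hM']
    exact trace_transpose_mul_diagonal_le hU hV hU' hV' he he0 (antitone_singVal M)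
      fun s => singVal_nonneg M s

theorem frobNorm_sq_eq_sum_singVal (M : Matrix (Fin p) (Fin m) ℝ) :
    frobNorm M ^ 2 = ∑ s : Fin (min p m), singVal M s ^ 2 := by
  obtain ⟨⟨U, V⟩, hU, hV, hM⟩ := exists_isSVD M
  rw [frobNorm_sq_eq_trace]
  conv_lhs => rw [hM]
  rw [trace_transpose_mul_diagonal_self hU hV]
  simp [sq]

/-- `MᵀM = V diag(x²) Vᵀ`, so powers act on the diagonal. The factor `M` in front handles the
constant term, since `V Vᵀ` need not be the identity. -/
theorem mul_aeval_transpose_mul_self {r : ℕ} {U : Matrix (Fin p) (Fin r) ℝ}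
    {V : Matrix (Fin m) (Fin r) ℝ} (hU : Uᵀ * U = 1) (hV : Vᵀ * V = 1) (x : Fin r → ℝ)
    (f : Polynomial ℝ) :
    (U * diagonal x * Vᵀ) * Polynomial.aeval ((U * diagonal x * Vᵀ)ᵀ * (U * diagonal x * Vᵀ)) f =
      U * diagonal (fun s => x s * f.eval (x s ^ 2)) * Vᵀ := by
  have hW : (U * diagonal x * Vᵀ)ᵀ * (U * diagonal x * Vᵀ) =
      V * (diagonal (fun s => x s ^ 2) * Vᵀ) := by
    simp only [transpose_mul, transpose_transpose, diagonal_transpose]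
    calc V * (diagonal x * Uᵀ) * (U * diagonal x * Vᵀ)
        = V * (diagonal x * (Uᵀ * U) * diagonal x * Vᵀ) := by simp only [Matrix.mul_assoc]
      _ = _ := by rw [hU, Matrix.mul_one, diagonal_mul_diagonal]; simp only [sq]
  have hpow : ∀ k : ℕ, (U * diagonal x * Vᵀ) * (V * (diagonal (fun s => x s ^ 2) * Vᵀ)) ^ k =
      U * diagonal (fun s => x s * (x s ^ 2) ^ k) * Vᵀ := by
    intro k
    induction k with
    | zero => simp
    | succ k ih =>
      rw [pow_succ, ← Matrix.mul_assoc, ih]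
      calc U * diagonal (fun s => x s * (x s ^ 2) ^ k) * Vᵀ * (V * (diagonal (fun s => x s ^ 2) * Vᵀ))
          = U * (diagonal (fun s => x s * (x s ^ 2) ^ k) * (Vᵀ * V) *
              diagonal (fun s => x s ^ 2)) * Vᵀ := by simp only [Matrix.mul_assoc]
        _ = _ := by
          rw [hV, Matrix.mul_one, diagonal_mul_diagonal]
          simp only [pow_succ, mul_assoc]
  rw [hW]
  induction f using Polynomial.induction_on' with
  | add f g hf hg =>
    rw [map_add, Matrix.mul_add, hf, hg, ← Matrix.add_mul, ← Matrix.mul_add, diagonal_add]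
    simp only [Polynomial.eval_add, mul_add]
  | monomial k c =>
    rw [Polynomial.aeval_monomial, ← Algebra.smul_def, Matrix.mul_smul, hpow, ← Matrix.smul_mul,
      ← Matrix.mul_smul, ← diagonal_smul]
    congr 3
    funext s
    simp only [Pi.smul_apply, smul_eq_mul, Polynomial.eval_monomial]
    ring

/-- `Θ^σ` does not depend on the choice of the singular value decomposition. -/
theorem diagonal_eq_of_diagonal_eq {r : ℕ} {U U' : Matrix (Fin p) (Fin r) ℝ}
    {V V' : Matrix (Fin m) (Fin r) ℝ} (hU : Uᵀ * U = 1) (hV : Vᵀ * V = 1)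
    (hU' : U'ᵀ * U' = 1) (hV' : V'ᵀ * V' = 1) {x : Fin r → ℝ} (hx : ∀ s, 0 ≤ x s)
    (h : U * diagonal x * Vᵀ = U' * diagonal x * V'ᵀ) {g : ℝ → ℝ} (hg : g 0 = 0) :
    U * diagonal (fun s => g (x s)) * Vᵀ = U' * diagonal (fun s => g (x s)) * V'ᵀ := by
  classical
  set N : Finset ℝ := Finset.univ.image fun s => x s ^ 2 with hN
  -- The right side of `mul_aeval_transpose_mul_self` depends on `M` alone, so it suffices to write
  -- `g(x) = x f(x²)` on the singular values. The value at `0` is immaterial because `g 0 = 0`.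
  set f := Lagrange.interpolate N id fun u => g (√u) / √u with hf
  have hfx : (fun s => g (x s)) = fun s => x s * f.eval (x s ^ 2) := by
    funext s
    have h1 : f.eval (x s ^ 2) = g (x s) / x s := by
      have h2 := Lagrange.eval_interpolate_at_node (s := N) (v := id) (i := x s ^ 2)
        (fun u => g (√u) / √u) (Set.injOn_id _) (by simp [hN])
      simpa only [id, Real.sqrt_sq (hx s), hf] using h2
    rw [h1]
    rcases eq_or_ne (x s) 0 with h0 | h0
    · rw [h0, hg]; simp
    · field_simp
  rw [hfx, ← mul_aeval_transpose_mul_self hU hV, h, mul_aeval_transpose_mul_self hU' hV']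

theorem matrixThreshold_eq {Θ : ℝ → ℝ → ℝ} {lam : ℝ} (h0 : Θ 0 lam = 0)
    {M : Matrix (Fin p) (Fin m) ℝ} {U : Matrix (Fin p) (Fin (min p m)) ℝ}
    {V : Matrix (Fin m) (Fin (min p m)) ℝ} (h : IsSVD M U V) :
    matrixThreshold Θ lam M =
      U * diagonal (fun s : Fin (min p m) => Θ (singVal M s) lam) * Vᵀ := by
  have h' := (exists_isSVD M).choose_spec
  exact diagonal_eq_of_diagonal_eq (g := fun t => Θ t lam) h'.orthonormal_left
    h'.orthonormal_right h.orthonormal_left h.orthonormal_right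
    (x := fun s : Fin (min p m) => singVal M s) (fun s => singVal_nonneg M s)
    (h'.eq.symm.trans h.eq) h0

/-- `Θ^σ(A)` minimizes the penalized Frobenius problem, with a quadratic margin. -/
theorem matrixThreshold_variational {Θ P : ℝ → ℝ → ℝ} {L lam : ℝ} (hΘ : IsThreshold Θ)
    (hL : IsCurvatureConst Θ L) (hP : IsPenaltyOf Θ P) (hlam : 0 ≤ lam)
    (A D : Matrix (Fin p) (Fin m) ℝ) :
    ((A - (1 - L) • matrixThreshold Θ lam A)ᵀ * (D - matrixThreshold Θ lam A)).trace -
        L / 2 * (frobNorm D ^ 2 - frobNorm (matrixThreshold Θ lam A) ^ 2) ≤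
      ∑ s : Fin (min p m), P (singVal D s) lam -
        ∑ s : Fin (min p m), P (singVal (matrixThreshold Θ lam A) s) lam := by
  obtain ⟨⟨U, V⟩, hUV⟩ := exists_isSVD A
  obtain ⟨⟨U', V'⟩, hU', hV', hD⟩ := exists_isSVD D
  have hA := hUV.eq
  have hU := hUV.orthonormal_left
  have hV := hUV.orthonormal_right
  have hC := matrixThreshold_eq (hΘ.map_zero hlam) hUV
  dsimp only at hA hU hV hC hD hU' hV'
  set C := matrixThreshold Θ lam A
  set θ : Fin (min p m) → ℝ := fun s => Θ (singVal A s) lam with hθ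
  set z : Fin (min p m) → ℝ := fun s => singVal A s - (1 - L) * θ s with hz
  have hθa : Antitone θ := fun s t hst => hΘ.mono lam hlam _ _ (antitone_singVal A hst)
  have hθ0 : ∀ s, 0 ≤ θ s := fun s => (hΘ.bounds lam hlam _ (singVal_nonneg A s)).1
  have hθ1 : ∀ s, θ s ≤ singVal A s := fun s => (hΘ.bounds lam hlam _ (singVal_nonneg A s)).2
  -- The curvature bound keeps `σ - (1 - L)Θ(σ)` ordered as the singular values are, which von
  -- Neumann's inequality requires.
  have hza : Antitone z := fun s t hst => by
    have := hL.mul_threshold_sub_le hΘ hlam (singVal_nonneg A t) (antitone_singVal A hst)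
    simp only [hz, hθ]
    linarith
  have hz0 : ∀ s, 0 ≤ z s := fun s => by
    simp only [hz]
    nlinarith [hθ0 s, hθ1 s, hL.nonneg]
  have hσC := singVal_eq_of_eq hU hV hθa hθ0 hC
  have hZ : A - (1 - L) • C = U * diagonal z * Vᵀ := by
    have h1 : diagonal z = diagonal (fun s : Fin (min p m) => singVal A s) -
        (1 - L) • diagonal θ := by
      rw [← diagonal_smul, diagonal_sub]
      rfl
    rw [h1, Matrix.mul_sub, Matrix.sub_mul, ← hA, Matrix.mul_smul, Matrix.smul_mul, ← hC]
  have hZD : ((A - (1 - L) • C)ᵀ * D).trace ≤ ∑ s : Fin (min p m), z s * singVal D s := by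
    rw [hZ]
    conv_lhs => rw [hD]
    exact trace_transpose_mul_diagonal_le hU hV hU' hV' hza hz0 (antitone_singVal D)
      fun s => singVal_nonneg D s
  have hZC : ((A - (1 - L) • C)ᵀ * C).trace = ∑ s, z s * θ s := by
    rw [hZ, hC, trace_transpose_mul_diagonal_self hU hV]
  have hCθ : ∀ s : Fin (min p m), singVal C s = θ s := fun s => congrFun hσC s
  rw [Matrix.mul_sub, Matrix.trace_sub, hZC, frobNorm_sq_eq_sum_singVal D,
    frobNorm_sq_eq_sum_singVal C]
  simp only [hCθ]
  have hsum := Finset.sum_le_sum fun (s : Fin (min p m)) (_ : s ∈ Finset.univ) =>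
    hP.sub_ge hL hΘ hlam (singVal_nonneg A s) (singVal_nonneg D s)
  have e1 : ∑ s : Fin (min p m), ((singVal A s - (1 - L) * Θ (singVal A s) lam) *
      (singVal D s - Θ (singVal A s) lam) -
        L / 2 * (singVal D s ^ 2 - Θ (singVal A s) lam ^ 2)) =
      ∑ s : Fin (min p m), z s * singVal D s - ∑ s, z s * θ s -
        L / 2 * (∑ s : Fin (min p m), singVal D s ^ 2 - ∑ s, θ s ^ 2) := by
    rw [← Finset.sum_sub_distrib, ← Finset.sum_sub_distrib, Finset.mul_sum,
      ← Finset.sum_sub_distrib]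
    exact Finset.sum_congr rfl fun s _ => by simp only [hz, hθ]; ring
  rw [e1, Finset.sum_sub_distrib] at hsum
  linarith

end Singular

end MatrixTISP

namespace MatrixTISP

/-! ### Continuity of matrix thresholding -/

section Continuity

open Matrix

variable {p m : ℕ}

theorem abs_le_one_of_transpose_mul_self {r : ℕ} {U : Matrix (Fin p) (Fin r) ℝ}
    (hU : Uᵀ * U = 1) (i : Fin p) (s : Fin r) : |U i s| ≤ 1 := by
  have h := congrFun (congrFun hU s) s
  rw [Matrix.mul_apply, Matrix.one_apply_eq] at h
  rw [abs_le_one_iff_mul_self_le_one, ← h]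
  exact Finset.single_le_sum (f := fun j => Uᵀ s j * U j s)
    (fun j _ => mul_self_nonneg (U j s)) (Finset.mem_univ i)

/-- Families of matrices with orthonormal columns converge along ultrafilters. -/
theorem exists_tendsto_of_transpose_mul_self {α : Type*} {r : ℕ} (g : Ultrafilter α)
    {U : α → Matrix (Fin p) (Fin r) ℝ} (hU : ∀ a, (U a)ᵀ * U a = 1) :
    ∃ W : Matrix (Fin p) (Fin r) ℝ, Wᵀ * W = 1 ∧ Tendsto U g (𝓝 W) := by
  have hK : IsCompact (Set.univ.pi fun _ : Fin p => Set.univ.pi fun _ : Fin r =>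
      Icc (-1 : ℝ) 1) := isCompact_univ_pi fun _ => isCompact_univ_pi fun _ => isCompact_Icc
  obtain ⟨W, -, hW⟩ := hK.ultrafilter_le_nhds (g.map U) (tendsto_principal.mpr
    (Eventually.of_forall fun a i _ s _ =>
      abs_le.mp (abs_le_one_of_transpose_mul_self (hU a) i s)))
  have hW' : Tendsto U g (𝓝 W) := hW
  refine ⟨W, ?_, hW'⟩
  have hc : Continuous fun Z : Matrix (Fin p) (Fin r) ℝ => Zᵀ * Z :=
    continuous_id.matrix_transpose.matrix_mul continuous_id
  have h1 := (hc.tendsto W).comp hW'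
  refine tendsto_nhds_unique h1 ?_
  simp only [Function.comp_def, hU]
  exact tendsto_const_nhds

/-- Singular vectors need not vary continuously, but along an ultrafilter they converge by
compactness. The limits form a decomposition of `A`, and any decomposition computes `Θ^σ(A)`. -/
theorem continuousAt_matrixThreshold {Θ : ℝ → ℝ → ℝ} {lam : ℝ} (h0 : Θ 0 lam = 0)
    (A : Matrix (Fin p) (Fin m) ℝ)
    (hA : ∀ s : Fin (min p m), ContinuousAt (fun t => Θ t lam) (singVal A s)) :
    ContinuousAt (matrixThreshold Θ lam) A := by
  have hspec := fun M : Matrix (Fin p) (Fin m) ℝ => (exists_isSVD M).choose_spec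
  set Uf := fun M : Matrix (Fin p) (Fin m) ℝ => (exists_isSVD M).choose.1
  set Vf := fun M : Matrix (Fin p) (Fin m) ℝ => (exists_isSVD M).choose.2
  refine tendsto_iff_ultrafilter _ _ _ |>.mpr fun g hg => ?_
  obtain ⟨U, hU, hUt⟩ := exists_tendsto_of_transpose_mul_self g
    (U := Uf) fun M => (hspec M).orthonormal_left
  obtain ⟨V, hV, hVt⟩ := exists_tendsto_of_transpose_mul_self g
    (U := Vf) fun M => (hspec M).orthonormal_right
  have hid : Tendsto (fun M : Matrix (Fin p) (Fin m) ℝ => M) g (𝓝 A) := hg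
  -- Read off as diagonal entries of `UᵀMV`, the singular values inherit convergence from `U`, `M`
  -- and `V`.
  have hσ : ∀ (M : Matrix (Fin p) (Fin m) ℝ) (s : Fin (min p m)),
      ((Uf M)ᵀ * M * Vf M) s s = singVal M s := by
    intro M s
    have h1 : (Uf M)ᵀ * M * Vf M = diagonal fun s : Fin (min p m) => singVal M s := by
      have hM : Uf M * diagonal (fun s : Fin (min p m) => singVal M s) * (Vf M)ᵀ = M :=
        (hspec M).eq.symm
      calc (Uf M)ᵀ * M * Vf M
          = (Uf M)ᵀ * (Uf M * diagonal (fun s : Fin (min p m) => singVal M s) * (Vf M)ᵀ) *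
              Vf M := by rw [hM]
        _ = ((Uf M)ᵀ * Uf M) * diagonal (fun s : Fin (min p m) => singVal M s) *
              ((Vf M)ᵀ * Vf M) := by simp only [Matrix.mul_assoc]
        _ = _ := by
          rw [show (Uf M)ᵀ * Uf M = 1 from (hspec M).orthonormal_left,
            show (Vf M)ᵀ * Vf M = 1 from (hspec M).orthonormal_right, Matrix.one_mul,
            Matrix.mul_one]
    rw [h1, diagonal_apply_eq]
  have hmul : ∀ {a b c : ℕ} {f : Matrix (Fin p) (Fin m) ℝ → Matrix (Fin a) (Fin b) ℝ}
      {f' : Matrix (Fin p) (Fin m) ℝ → Matrix (Fin b) (Fin c) ℝ} {F F'},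
      Tendsto f g (𝓝 F) → Tendsto f' g (𝓝 F') →
      Tendsto (fun M => f M * f' M) g (𝓝 (F * F')) := fun {a b c f f' F F'} hf hf' =>
    ((continuous_fst.matrix_mul continuous_snd).tendsto (F, F')).comp (hf.prodMk_nhds hf')
  have htr : ∀ {a b : ℕ} {f : Matrix (Fin p) (Fin m) ℝ → Matrix (Fin a) (Fin b) ℝ} {F},
      Tendsto f g (𝓝 F) → Tendsto (fun M => (f M)ᵀ) g (𝓝 Fᵀ) := fun {a b f F} hf =>
    ((continuous_id.matrix_transpose).tendsto F).comp hf
  have hdg : ∀ {f : Matrix (Fin p) (Fin m) ℝ → Fin (min p m) → ℝ} {F},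
      (∀ s, Tendsto (fun M => f M s) g (𝓝 (F s))) →
      Tendsto (fun M => diagonal (f M)) g (𝓝 (diagonal F)) := fun {f F} hf =>
    ((continuous_id.matrix_diagonal).tendsto F).comp (tendsto_pi_nhds.mpr hf)
  set d : Fin (min p m) → ℝ := fun s => (Uᵀ * A * V) s s
  have hd : ∀ s : Fin (min p m), Tendsto (fun M : Matrix (Fin p) (Fin m) ℝ => singVal M s) g (𝓝 (d s)) := by
    intro s
    have h1 := hmul (hmul (htr hUt) hid) hVt
    have h2 := tendsto_pi_nhds.mp (tendsto_pi_nhds.mp h1 s) s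
    exact h2.congr fun M => hσ M s
  have hda : Antitone d := fun s t hst =>
    le_of_tendsto_of_tendsto' (hd t) (hd s) fun M => antitone_singVal M hst
  have hd0 : ∀ s, 0 ≤ d s := fun s => ge_of_tendsto' (hd s) fun M => singVal_nonneg M s
  have hAeq : A = U * diagonal d * Vᵀ := by
    refine tendsto_nhds_unique hid ?_
    exact (hmul (hmul hUt (hdg hd)) (htr hVt)).congr fun M => (hspec M).eq.symm
  have hsd : ∀ s : Fin (min p m), singVal A s = d s := fun s =>
    congrFun (singVal_eq_of_eq hU hV hda hd0 hAeq) s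
  have hsvd : IsSVD A U V := ⟨hU, hV, by simp only [hsd]; exact hAeq⟩
  rw [matrixThreshold_eq h0 hsvd]
  exact hmul (hmul hUt (hdg fun s => (hA s).tendsto.comp (by rw [hsd]; exact hd s))) (htr hVt)

end Continuity

/-! ### The cumulant function -/

namespace NatExpFamily

open ProbabilityTheory

variable (fam : NatExpFamily)

/-- The dominating measure weighted by `exp (c(y))`. -/
noncomputable def weighted : Measure ℝ :=
  fam.base.withDensity fun y => ENNReal.ofReal (Real.exp (fam.c y))

theorem natParam_eq : fam.natParam = interior (integrableExpSet id fam.weighted) := by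
  have hm : Measurable fun y => ENNReal.ofReal (Real.exp (fam.c y)) :=
    (Real.measurable_exp.comp fam.measurable_c).ennreal_ofReal
  refine congrArg interior (Set.ext fun θ => ?_)
  change Integrable _ _ ↔ Integrable _ _
  rw [weighted, integrable_withDensity_iff_integrable_smul' hm (by simp)]
  refine iff_of_eq (congrArg (fun f => Integrable f fam.base) (funext fun y => ?_))
  rw [ENNReal.toReal_ofReal (Real.exp_pos _).le, smul_eq_mul, ← Real.exp_add, id, mul_comm θ,
    add_comm]

/-- As a cumulant generating function, `b` is analytic on the interior of its domain. -/
theorem b_eq_cgf : fam.b = cgf id fam.weighted := by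
  have hm : Measurable fun y => ENNReal.ofReal (Real.exp (fam.c y)) :=
    (Real.measurable_exp.comp fam.measurable_c).ennreal_ofReal
  funext θ
  rw [b, cgf, mgf, weighted, integral_withDensity_eq_integral_toReal_smul hm (by simp)]
  refine congrArg Real.log (integral_congr_ae (Eventually.of_forall fun y => ?_))
  dsimp only
  rw [ENNReal.toReal_ofReal (Real.exp_pos _).le, smul_eq_mul, ← Real.exp_add, id, mul_comm θ,
    add_comm]

theorem analyticAt_b {θ : ℝ} (hθ : θ ∈ fam.natParam) : AnalyticAt ℝ fam.b θ := by
  rw [b_eq_cgf]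
  exact analyticAt_cgf (by rwa [← natParam_eq])

theorem hasDerivAt_b {θ : ℝ} (hθ : θ ∈ fam.natParam) : HasDerivAt fam.b (deriv fam.b θ) θ :=
  (fam.analyticAt_b hθ).differentiableAt.hasDerivAt

theorem hasDerivAt_deriv_b {θ : ℝ} (hθ : θ ∈ fam.natParam) :
    HasDerivAt (deriv fam.b) (iteratedDeriv 2 fam.b θ) θ := by
  rw [iteratedDeriv_succ, iteratedDeriv_one]
  exact (fam.analyticAt_b hθ).deriv.differentiableAt.hasDerivAt

theorem convex_natParam : Convex ℝ fam.natParam := by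
  rw [natParam_eq]
  exact convex_integrableExpSet.interior

end NatExpFamily

/-- Second order Taylor bound on the unit interval. -/
theorem le_add_of_second_deriv_le {f f' f'' : ℝ → ℝ} {K : ℝ}
    (hf : ∀ t ∈ Icc (0 : ℝ) 1, HasDerivAt f (f' t) t)
    (hf' : ∀ t ∈ Icc (0 : ℝ) 1, HasDerivAt f' (f'' t) t)
    (hK : ∀ t ∈ Ioo (0 : ℝ) 1, f'' t ≤ K) : f 1 ≤ f 0 + f' 0 + K / 2 := by
  have h1 : ∀ t ∈ Icc (0 : ℝ) 1, HasDerivAt (fun t => f' t - K * t) (f'' t - K) t :=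
    fun t ht => ((hf' t ht).sub ((hasDerivAt_id t).const_mul K)).congr_deriv (by simp)
  have a1 : AntitoneOn (fun t => f' t - K * t) (Icc 0 1) := by
    refine antitoneOn_of_hasDerivWithinAt_nonpos (convex_Icc 0 1)
      (fun t ht => (h1 t ht).continuousAt.continuousWithinAt)
      (fun t ht => (h1 t (interior_subset ht)).hasDerivWithinAt) fun t ht => ?_
    rw [interior_Icc] at ht
    linarith [hK t ht]
  have h2 : ∀ t ∈ Icc (0 : ℝ) 1, HasDerivAt (fun t => f t - f' 0 * t - K / 2 * t ^ 2)
      (f' t - f' 0 - K * t) t := fun t ht => by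
    have := ((hf t ht).sub ((hasDerivAt_id t).const_mul (f' 0))).sub
      (((hasDerivAt_id t).pow 2).const_mul (K / 2))
    refine this.congr_deriv ?_
    simp
    ring
  have a2 : AntitoneOn (fun t => f t - f' 0 * t - K / 2 * t ^ 2) (Icc 0 1) := by
    refine antitoneOn_of_hasDerivWithinAt_nonpos (convex_Icc 0 1)
      (fun t ht => (h2 t ht).continuousAt.continuousWithinAt)
      (fun t ht => (h2 t (interior_subset ht)).hasDerivWithinAt) fun t ht => ?_
    have ht' := interior_subset ht
    have := a1 (left_mem_Icc.mpr zero_le_one) ht' ht'.1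
    simp only [mul_zero, sub_zero] at this
    linarith
  have := a2 (left_mem_Icc.mpr zero_le_one) (right_mem_Icc.mpr zero_le_one) zero_le_one
  norm_num at this
  linarith

/-! ### Descent of the objective -/

section Descent

open Matrix

variable {n p m : ℕ}

theorem dotProduct_mulVec_le_specNorm {d : ℕ} (A : Matrix (Fin d) (Fin d) ℝ) (v : Fin d → ℝ) :
    v ⬝ᵥ (A *ᵥ v) ≤ specNorm A * ∑ r, v r ^ 2 := by
  have h1 : v ⬝ᵥ (A *ᵥ v) =
      inner ℝ (Matrix.toEuclideanCLM (𝕜 := ℝ) A (WithLp.toLp 2 v)) (WithLp.toLp 2 v) := by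
    simp [PiLp.inner_apply, dotProduct]
  have h2 : ∑ r, v r ^ 2 = ‖WithLp.toLp 2 v‖ * ‖WithLp.toLp 2 v‖ := by
    rw [← sq, EuclideanSpace.norm_sq_eq]
    simp
  rw [h1, h2, specNorm, ← mul_assoc]
  exact (real_inner_le_norm _ _).trans
    (mul_le_mul_of_nonneg_right (ContinuousLinearMap.le_opNorm _ _) (norm_nonneg _))

theorem dotProduct_infoMatrix_mulVec (fam : NatExpFamily) (X : Matrix (Fin n) (Fin (p + 1)) ℝ)
    (β v : Fin (p + 1) → ℝ) :
    v ⬝ᵥ (infoMatrix fam X β *ᵥ v) =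
      ∑ i, iteratedDeriv 2 fam.b ((X *ᵥ β) i) * (X *ᵥ v) i ^ 2 := by
  rw [infoMatrix, ← Matrix.mulVec_mulVec, ← Matrix.mulVec_mulVec, Matrix.dotProduct_mulVec,
    Matrix.vecMul_transpose]
  refine Finset.sum_congr rfl fun i _ => ?_
  rw [Matrix.mulVec_diagonal]
  ring

/-- Second order expansion of the cumulant part of the loss in one column. -/
theorem sum_b_mulVec_le (fam : NatExpFamily) (X : Matrix (Fin n) (Fin (p + 1)) ℝ)
    {β γ : Fin (p + 1) → ℝ} {K : ℝ} (hβ : ∀ i, (X *ᵥ β) i ∈ fam.natParam)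
    (hγ : ∀ i, (X *ᵥ γ) i ∈ fam.natParam)
    (hK : ∀ t ∈ Ioo (0 : ℝ) 1, specNorm (infoMatrix fam X (t • β + (1 - t) • γ)) ≤ K) :
    ∑ i, fam.b ((X *ᵥ γ) i) ≤ ∑ i, fam.b ((X *ᵥ β) i) +
      ∑ i, deriv fam.b ((X *ᵥ β) i) * (X *ᵥ (γ - β)) i + K / 2 * ∑ r, (γ - β) r ^ 2 := by
  set η := X *ᵥ β with hη
  set δ := X *ᵥ (γ - β) with hδ
  have hγη : ∀ i, (X *ᵥ γ) i = η i + 1 * δ i := fun i => by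
    rw [hδ, Matrix.mulVec_sub, Pi.sub_apply]; ring
  have hmem : ∀ t ∈ Icc (0 : ℝ) 1, ∀ i, η i + t * δ i ∈ fam.natParam := fun t ht i => by
    have h1 := fam.convex_natParam (hβ i) (hγ i) (sub_nonneg.mpr ht.2) ht.1 (by ring)
    rw [hγη] at h1
    convert h1 using 1
    simp only [smul_eq_mul]
    ring
  have hlin : ∀ (i : Fin n) (t : ℝ), HasDerivAt (fun t => η i + t * δ i) (δ i) t := fun i t => by
    simpa using ((hasDerivAt_id t).mul_const (δ i)).const_add (η i)
  have hd1 : ∀ t ∈ Icc (0 : ℝ) 1, HasDerivAt (fun t => ∑ i, fam.b (η i + t * δ i))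
      (∑ i, deriv fam.b (η i + t * δ i) * δ i) t := fun t ht =>
    HasDerivAt.fun_sum fun i _ =>
      HasDerivAt.comp (h₂ := fam.b) t (fam.hasDerivAt_b (hmem t ht i)) (hlin i t)
  have hd2 : ∀ t ∈ Icc (0 : ℝ) 1,
      HasDerivAt (fun t => ∑ i, deriv fam.b (η i + t * δ i) * δ i)
        (∑ i, iteratedDeriv 2 fam.b (η i + t * δ i) * δ i * δ i) t := fun t ht =>
    HasDerivAt.fun_sum fun i _ =>
      (HasDerivAt.comp t (fam.hasDerivAt_deriv_b (hmem t ht i)) (hlin i t)).mul_const (δ i)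
  have h := le_add_of_second_deriv_le (K := K * ∑ r, (γ - β) r ^ 2) hd1 hd2 fun t ht => by
    -- Time `t` from `β` to `γ` puts weight `1 - t` on `β`, whereas `hK` weights `β` by its
    -- parameter.
    have h1 := dotProduct_mulVec_le_specNorm
      (infoMatrix fam X ((1 - t) • β + (1 - (1 - t)) • γ)) (γ - β)
    rw [dotProduct_infoMatrix_mulVec] at h1
    refine le_trans (le_of_eq (Finset.sum_congr rfl fun i _ => ?_)) (h1.trans
      (mul_le_mul_of_nonneg_right (hK (1 - t) ⟨by linarith [ht.2], by linarith [ht.1]⟩)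
        (Finset.sum_nonneg fun r _ => sq_nonneg _)))
    have h2 : (X *ᵥ ((1 - t) • β + (1 - (1 - t)) • γ)) i = η i + t * δ i := by
      rw [Matrix.mulVec_add, Matrix.mulVec_smul, Matrix.mulVec_smul, Pi.add_apply, Pi.smul_apply,
        Pi.smul_apply, hγη, smul_eq_mul, smul_eq_mul]
      ring
    rw [h2, hδ]
    ring
  simp only [hγη]
  simp only [zero_mul, add_zero] at h
  linarith

/-- The negative log-likelihood. -/
noncomputable def negLogLik (fam : NatExpFamily) (X : Matrix (Fin n) (Fin (p + 1)) ℝ)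
    (Y : Matrix (Fin n) (Fin m) ℝ) (B : Matrix (Fin (p + 1)) (Fin m) ℝ) : ℝ :=
  ∑ k : Fin m, ∑ i : Fin n, (fam.b ((X * B) i k) - Y i k * (X * B) i k - fam.c (Y i k))

theorem objective_eq (fam : NatExpFamily) (P : ℝ → ℝ → ℝ) (lam : ℝ)
    (X : Matrix (Fin n) (Fin (p + 1)) ℝ) (Y : Matrix (Fin n) (Fin m) ℝ)
    (B : Matrix (Fin (p + 1)) (Fin m) ℝ) :
    objective fam P lam X Y B =
      negLogLik fam X Y B + ∑ s : Fin (min p m), P (singVal (noIntercept B) s) lam := by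
  rw [objective, negLogLik, ← Finset.sum_neg_distrib]
  congr 1
  refine Finset.sum_congr rfl fun k _ => ?_
  rw [← Finset.sum_neg_distrib]
  refine Finset.sum_congr rfl fun i _ => ?_
  rw [NatExpFamily.density, Real.log_exp]
  change -(Y i k * (X * B) i k - fam.b ((X * B) i k) + fam.c (Y i k)) = _
  ring

/-- With the canonical link the data enter linearly, so only the cumulant leaves a second-order
remainder, controlled column by column with the common `K`. -/
theorem negLogLik_le (fam : NatExpFamily) (X : Matrix (Fin n) (Fin (p + 1)) ℝ)
    (Y : Matrix (Fin n) (Fin m) ℝ) {B C : Matrix (Fin (p + 1)) (Fin m) ℝ} {K : ℝ}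
    (hB : ∀ i k, (X * B) i k ∈ fam.natParam) (hC : ∀ i k, (X * C) i k ∈ fam.natParam)
    (hK : ∀ k, ∀ t ∈ Ioo (0 : ℝ) 1,
      specNorm (infoMatrix fam X (t • (fun r => B r k) + (1 - t) • (fun r => C r k))) ≤ K) :
    negLogLik fam X Y C ≤ negLogLik fam X Y B -
      ((Xᵀ * (Y - meanMatrix fam X B))ᵀ * (C - B)).trace + K / 2 * frobNorm (C - B) ^ 2 := by
  have h1 : ((Xᵀ * (Y - meanMatrix fam X B))ᵀ * (C - B)).trace =
      ∑ k, ∑ i, (Y i k - deriv fam.b ((X * B) i k)) * (X *ᵥ ((fun r => C r k) - fun r => B r k)) i := by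
    rw [transpose_mul, transpose_transpose, Matrix.mul_assoc, trace_transpose_mul_eq_sum,
      Finset.sum_comm]
    rfl
  have h0 : frobNorm (C - B) ^ 2 = ∑ k, ∑ r, (C - B) r k ^ 2 := by
    rw [frobNorm_sq, Finset.sum_comm]
  rw [h1, h0, negLogLik, negLogLik, Finset.mul_sum,
    ← Finset.sum_sub_distrib, ← Finset.sum_add_distrib]
  refine Finset.sum_le_sum fun k _ => ?_
  have h2 := sum_b_mulVec_le fam X (fun i => hB i k) (fun i => hC i k) (hK k)
  have h3 : ∀ i, (X *ᵥ ((fun r => C r k) - fun r => B r k)) i = (X * C) i k - (X * B) i k :=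
    fun i => by rw [Matrix.mulVec_sub]; rfl
  simp only [h3] at h2 ⊢
  have h4 : ∀ M : Matrix (Fin (p + 1)) (Fin m) ℝ, ∀ i, (X *ᵥ fun r => M r k) i = (X * M) i k :=
    fun _ _ => rfl
  have h5 : ∑ r, ((fun r => C r k) - fun r => B r k) r ^ 2 = ∑ r, (C - B) r k ^ 2 := rfl
  rw [h5] at h2
  simp only [h4] at h2
  have h6 : ∑ i, (fam.b ((X * C) i k) - Y i k * (X * C) i k - fam.c (Y i k)) =
      ∑ i, fam.b ((X * C) i k) - ∑ i, (Y i k * (X * C) i k + fam.c (Y i k)) := by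
    rw [← Finset.sum_sub_distrib]
    exact Finset.sum_congr rfl fun i _ => by ring
  have h7 : ∑ i, (fam.b ((X * B) i k) - Y i k * (X * B) i k - fam.c (Y i k)) -
        ∑ i, (Y i k - deriv fam.b ((X * B) i k)) * ((X * C) i k - (X * B) i k) =
      ∑ i, fam.b ((X * B) i k) + ∑ i, deriv fam.b ((X * B) i k) * ((X * C) i k - (X * B) i k) -
        ∑ i, (Y i k * (X * C) i k + fam.c (Y i k)) := by
    rw [← Finset.sum_sub_distrib, ← Finset.sum_add_distrib, ← Finset.sum_sub_distrib]
    exact Finset.sum_congr rfl fun i _ => by ring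
  rw [h6, h7]
  linarith

theorem frobNorm_sub_comm (A B : Matrix (Fin p) (Fin m) ℝ) : frobNorm (A - B) = frobNorm (B - A) :=
  open scoped Matrix.Norms.Frobenius in norm_sub_rev A B

/-- One step of the iteration decreases the objective. -/
theorem objective_sub_ge {Θ P : ℝ → ℝ → ℝ} {L lam K : ℝ} (hΘ : IsThreshold Θ)
    (hL : IsCurvatureConst Θ L) (hP : IsPenaltyOf Θ P) (hlam : 0 ≤ lam) (fam : NatExpFamily)
    (X : Matrix (Fin n) (Fin (p + 1)) ℝ) (Y : Matrix (Fin n) (Fin m) ℝ)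
    {B C : Matrix (Fin (p + 1)) (Fin m) ℝ}
    (hB : ∀ i k, (X * B) i k ∈ fam.natParam) (hC : ∀ i k, (X * C) i k ∈ fam.natParam)
    (hK : ∀ k, ∀ t ∈ Ioo (0 : ℝ) 1,
      specNorm (infoMatrix fam X (t • (fun r => B r k) + (1 - t) • (fun r => C r k))) ≤ K)
    (hstep : noIntercept C = matrixThreshold Θ lam (tispArg fam X Y B))
    (hstep0 : C 0 = B 0 + interceptScore fam X Y B) :
    (2 - L - K) * frobNorm (B - C) ^ 2 / 2 ≤
      objective fam P lam X Y B - objective fam P lam X Y C := by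
  have h1 := negLogLik_le fam X Y hB hC hK
  have h2 := matrixThreshold_variational hΘ hL hP hlam (tispArg fam X Y B) (noIntercept B)
  rw [← hstep] at h2
  set R := Y - meanMatrix fam X B with hR
  set G := (noFirstCol X)ᵀ * R with hG
  set E := noIntercept C - noIntercept B with hE
  have hA : tispArg fam X Y B = noIntercept B + G := by
    rw [tispArg, hG, hR, Matrix.mul_sub]
    abel
  have hD0 : ∀ k, (C - B) 0 k = interceptScore fam X Y B k := fun k => by
    rw [Matrix.sub_apply, hstep0, Pi.add_apply, add_sub_cancel_left]
  -- The intercept increment is exactly the intercept score, so that row pairs to its own squared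
  -- norm.
  have htr : ((Xᵀ * R)ᵀ * (C - B)).trace = ∑ k, (C - B) 0 k ^ 2 + (Gᵀ * E).trace := by
    rw [trace_transpose_mul_eq_sum, trace_transpose_mul_eq_sum, Fin.sum_univ_succ]
    congr 1
    refine Finset.sum_congr rfl fun k _ => ?_
    rw [hD0, sq]
    congr 1
    simp only [interceptScore, Matrix.mul_apply, Matrix.mulVec, dotProduct, transpose_apply]
    exact Finset.sum_congr rfl fun i _ => mul_comm _ _
  have hfr : frobNorm (C - B) ^ 2 = ∑ k, (C - B) 0 k ^ 2 + frobNorm E ^ 2 := by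
    rw [frobNorm_sq, frobNorm_sq, Fin.sum_univ_succ]
    rfl
  have hmain : ((tispArg fam X Y B - (1 - L) • noIntercept C)ᵀ *
      (noIntercept B - noIntercept C)).trace -
        L / 2 * (frobNorm (noIntercept B) ^ 2 - frobNorm (noIntercept C) ^ 2) =
      (2 - L) / 2 * frobNorm E ^ 2 - (Gᵀ * E).trace := by
    rw [hA, hE]
    simp only [trace_transpose_mul_eq_sum, frobNorm_sq, Finset.mul_sum, ← Finset.sum_sub_distrib]
    refine Finset.sum_congr rfl fun i _ => Finset.sum_congr rfl fun k _ => ?_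
    simp only [Matrix.sub_apply, Matrix.add_apply, Matrix.smul_apply, smul_eq_mul]
    ring
  rw [hmain] at h2
  rw [htr] at h1
  have h0 : 0 ≤ ∑ k, (C - B) 0 k ^ 2 := Finset.sum_nonneg fun k _ => sq_nonneg _
  rw [objective_eq, objective_eq, frobNorm_sub_comm, hfr]
  rw [hfr] at h1
  -- The intercept row gains `1 - K/2`, which is at least `(2 - L - K)/2` because `L ≥ 0`.
  nlinarith [hL.nonneg]

theorem specNorm_le_rho (fam : NatExpFamily) (X : Matrix (Fin n) (Fin (p + 1)) ℝ)
    {B : ℕ → Matrix (Fin (p + 1)) (Fin m) ℝ} (hρ : rho fam X B ≠ ⊤) {k : Fin m}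
    {ξ : Fin (p + 1) → ℝ} (hξ : ξ ∈ segmentSet B k) :
    specNorm (infoMatrix fam X ξ) ≤ (rho fam X B).toReal := by
  rw [← ENNReal.ofReal_le_iff_le_toReal hρ]
  exact le_iSup_of_le k (le_iSup₂_of_le ξ hξ le_rfl)

end Descent

/-! ### Limit points -/

section Limit

variable {n p m : ℕ}

theorem continuous_linearPredictor (X : Matrix (Fin n) (Fin (p + 1)) ℝ) (i : Fin n) (k : Fin m) :
    Continuous fun B : Matrix (Fin (p + 1)) (Fin m) ℝ => (X * B) i k :=
  (continuous_const.matrix_mul continuous_id).matrix_elem i k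

theorem continuousAt_negLogLik (fam : NatExpFamily) (X : Matrix (Fin n) (Fin (p + 1)) ℝ)
    (Y : Matrix (Fin n) (Fin m) ℝ) {B : Matrix (Fin (p + 1)) (Fin m) ℝ}
    (hB : ∀ i k, (X * B) i k ∈ fam.natParam) : ContinuousAt (negLogLik fam X Y) B := by
  refine tendsto_finsetSum _ fun k _ => tendsto_finsetSum _ fun i _ => ?_
  have hc := (continuous_linearPredictor X i k).continuousAt (x := B)
  have hb : ContinuousAt (fun B : Matrix (Fin (p + 1)) (Fin m) ℝ => fam.b ((X * B) i k)) B :=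
    ContinuousAt.comp (f := fun B : Matrix (Fin (p + 1)) (Fin m) ℝ => (X * B) i k)
      (fam.analyticAt_b (hB i k)).continuousAt hc
  exact (hb.sub (hc.const_mul _)).sub continuousAt_const

theorem continuousAt_meanMatrix (fam : NatExpFamily) (X : Matrix (Fin n) (Fin (p + 1)) ℝ)
    {B : Matrix (Fin (p + 1)) (Fin m) ℝ} (hB : ∀ i k, (X * B) i k ∈ fam.natParam) :
    ContinuousAt (meanMatrix fam X) B := by
  refine tendsto_pi_nhds.mpr fun i => tendsto_pi_nhds.mpr fun k => ?_
  exact ContinuousAt.comp (f := fun B : Matrix (Fin (p + 1)) (Fin m) ℝ => (X * B) i k)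
    (fam.analyticAt_b (hB i k)).deriv.continuousAt
    (continuous_linearPredictor X i k).continuousAt

theorem continuous_noIntercept :
    Continuous (noIntercept : Matrix (Fin (p + 1)) (Fin m) ℝ → Matrix (Fin p) (Fin m) ℝ) :=
  continuous_id.matrix_submatrix _ _

theorem continuousAt_tispArg (fam : NatExpFamily) (X : Matrix (Fin n) (Fin (p + 1)) ℝ)
    (Y : Matrix (Fin n) (Fin m) ℝ) {B : Matrix (Fin (p + 1)) (Fin m) ℝ}
    (hB : ∀ i k, (X * B) i k ∈ fam.natParam) : ContinuousAt (tispArg fam X Y) B := by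
  have hm := continuousAt_meanMatrix fam X hB
  have hc : Continuous fun M : Matrix (Fin n) (Fin m) ℝ => (noFirstCol X).transpose * M :=
    continuous_const.matrix_mul continuous_id
  exact (continuous_noIntercept.continuousAt.add continuousAt_const).sub
    (ContinuousAt.comp hc.continuousAt hm)

theorem continuousAt_interceptScore (fam : NatExpFamily) (X : Matrix (Fin n) (Fin (p + 1)) ℝ)
    (Y : Matrix (Fin n) (Fin m) ℝ) {B : Matrix (Fin (p + 1)) (Fin m) ℝ}
    (hB : ∀ i k, (X * B) i k ∈ fam.natParam) : ContinuousAt (interceptScore fam X Y) B := by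
  have hm := continuousAt_meanMatrix fam X hB
  have hc : Continuous fun M : Matrix (Fin n) (Fin m) ℝ =>
      (Y - M).transpose.mulVec (fun i => X i 0) :=
    (continuous_const.sub continuous_id).matrix_transpose.matrix_mulVec continuous_const
  exact ContinuousAt.comp hc.continuousAt hm

/-- The increments of a sequence vanish if their squares are dominated by the decrements of a
function that decreases along the sequence and is frequently bounded below. -/
theorem tendsto_increment_zero {B : ℕ → Matrix (Fin p) (Fin m) ℝ} {f : ℕ → ℝ} {c M : ℝ}
    (hc : 0 < c) (hstep : ∀ j, 1 ≤ j → c * frobNorm (B j - B (j + 1)) ^ 2 ≤ f j - f (j + 1))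
    (hf : AntitoneOn f (Ici 1)) (hM : ∃ᶠ j in atTop, M ≤ f j) :
    Tendsto (fun j => B (j + 1) - B j) atTop (𝓝 0) := by
  -- Monotonicity spreads a bound at infinitely many indices to all of them.
  have hlow : ∀ i, 1 ≤ i → M ≤ f i := fun i hi => by
    obtain ⟨j, hj, hMj⟩ := frequently_atTop.mp hM i
    exact hMj.trans (hf hi (hi.trans hj) hj)
  have hanti : Antitone fun j => f (j + 1) := fun i j hij =>
    hf (Nat.le_add_left 1 i) (Nat.le_add_left 1 j) (by omega)
  have hlim := tendsto_atTop_ciInf hanti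
    ⟨M, by rintro _ ⟨j, rfl⟩; exact hlow _ (Nat.le_add_left 1 j)⟩
  have hlim' := (tendsto_add_atTop_iff_nat 1).mp hlim
  have hdiff : Tendsto (fun j => (f j - f (j + 1)) / c) atTop (𝓝 0) := by
    simpa using (hlim'.sub hlim).div_const c
  refine tendsto_pi_nhds.mpr fun r => tendsto_pi_nhds.mpr fun k => ?_
  have hsq : Tendsto (fun j => ((B (j + 1) - B j) r k) ^ 2) atTop (𝓝 0) := by
    refine squeeze_zero' (Eventually.of_forall fun j => sq_nonneg _)
      ((eventually_ge_atTop 1).mono fun j hj => ?_) hdiff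
    rw [le_div_iff₀ hc]
    refine le_trans ?_ (hstep j hj)
    rw [mul_comm, frobNorm_sub_comm, frobNorm_sq]
    refine mul_le_mul_of_nonneg_left ?_ hc.le
    exact (Finset.single_le_sum (f := fun k => (B (j + 1) - B j) r k ^ 2)
      (fun _ _ => sq_nonneg _) (Finset.mem_univ k)).trans
      (Finset.single_le_sum (f := fun r => ∑ k, (B (j + 1) - B j) r k ^ 2)
        (fun _ _ => Finset.sum_nonneg fun _ _ => sq_nonneg _) (Finset.mem_univ r))
  have habs := (Real.continuous_sqrt.tendsto 0).comp hsq
  simp only [Function.comp_def, Real.sqrt_sq_eq_abs, Real.sqrt_zero] at habs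
  exact (tendsto_zero_iff_abs_tendsto_zero _).mpr habs

end Limit

end MatrixTISP

/-! ### Descent and limit points of the iteration -/

theorem mainTheorem1 {n p m : ℕ}
    (Θ : ℝ → ℝ → ℝ) (hΘ : MatrixTISP.IsThreshold Θ)
    (L : ℝ) (hL : MatrixTISP.IsCurvatureConst Θ L)
    (P : ℝ → ℝ → ℝ) (hP : MatrixTISP.IsPenaltyOf Θ P)
    (lam : ℝ) (hlam : 0 ≤ lam)
    (fam : MatrixTISP.NatExpFamily)
    (X : Matrix (Fin n) (Fin (p + 1)) ℝ) (Y : Matrix (Fin n) (Fin m) ℝ)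
    (B : ℕ → Matrix (Fin (p + 1)) (Fin m) ℝ)
    (hB : MatrixTISP.IsMatrixTISP Θ lam fam X Y B)
    (hparam : ∀ j i k, (X * B j) i k ∈ fam.natParam)
    (hρ : MatrixTISP.rho fam X B < ENNReal.ofReal (2 - L)) :
    AntitoneOn (fun j => MatrixTISP.objective fam P lam X Y (B j)) (Ici 1) ∧
    (∀ j : ℕ, 1 ≤ j →
      MatrixTISP.objective fam P lam X Y (B j) - MatrixTISP.objective fam P lam X Y (B (j + 1)) ≥
        (2 - L - (MatrixTISP.rho fam X B).toReal) *
          MatrixTISP.frobNorm (B j - B (j + 1)) ^ 2 / 2) ∧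
    (∀ Bstar : Matrix (Fin (p + 1)) (Fin m) ℝ,
      MapClusterPt Bstar atTop B →
      (∀ i k, (X * Bstar) i k ∈ fam.natParam) →
      (∀ s : Fin (min p m), ContinuousAt (fun t => Θ t lam)
        (MatrixTISP.singVal (MatrixTISP.tispArg fam X Y Bstar) s)) →
      MatrixTISP.noIntercept Bstar =
          MatrixTISP.matrixThreshold Θ lam (MatrixTISP.tispArg fam X Y Bstar) ∧
        0 = MatrixTISP.interceptScore fam X Y Bstar) := by
  have hρtop : MatrixTISP.rho fam X B ≠ ⊤ := ne_top_of_lt hρ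
  have hgap : 0 < 2 - L - (MatrixTISP.rho fam X B).toReal := by
    have := (ENNReal.lt_ofReal_iff_toReal_lt hρtop).mp hρ
    linarith
  have hdesc : ∀ j : ℕ, 1 ≤ j →
      (2 - L - (MatrixTISP.rho fam X B).toReal) * MatrixTISP.frobNorm (B j - B (j + 1)) ^ 2 / 2 ≤
      MatrixTISP.objective fam P lam X Y (B j) -
        MatrixTISP.objective fam P lam X Y (B (j + 1)) := fun j hj =>
    MatrixTISP.objective_sub_ge hΘ hL hP hlam fam X Y (hparam j) (hparam (j + 1))
      (fun k t ht => MatrixTISP.specNorm_le_rho fam X hρtop ⟨t, ht, j, hj, rfl⟩)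
      (hB j).1 (hB j).2
  have hanti : AntitoneOn (fun j => MatrixTISP.objective fam P lam X Y (B j)) (Ici 1) := by
    intro i hi j _ hij
    induction j, hij using Nat.le_induction with
    | base => exact le_rfl
    | succ j hij ih =>
      have h1 : 1 ≤ j := le_trans hi hij
      have h2 := hdesc j h1
      have h3 : 0 ≤ (2 - L - (MatrixTISP.rho fam X B).toReal) *
        MatrixTISP.frobNorm (B j - B (j + 1)) ^ 2 / 2 := by positivity
      have h4 := ih h1
      dsimp only at h4 ⊢
      linarith
  refine ⟨hanti, hdesc, fun Bstar hcl hstar hcont => ?_⟩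
  obtain ⟨g, hg, hBg⟩ := mapClusterPt_iff_ultrafilter.mp hcl
  -- The loss is continuous at `Bstar` and each penalty term is at least `P(0)`.
  have hlow : ∀ᶠ j in (g : Filter ℕ), MatrixTISP.negLogLik fam X Y Bstar - 1 +
      ∑ _s : Fin (min p m), P 0 lam ≤ MatrixTISP.objective fam P lam X Y (B j) := by
    have h1 := (MatrixTISP.continuousAt_negLogLik fam X Y hstar).tendsto.comp hBg
    filter_upwards [h1.eventually_const_le (sub_one_lt _)] with j hj
    rw [MatrixTISP.objective_eq]
    exact add_le_add hj (Finset.sum_le_sum fun s _ => hP.zero_le hΘ hlam _)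
  have hinc := (MatrixTISP.tendsto_increment_zero (B := B)
    (f := fun j => MatrixTISP.objective fam P lam X Y (B j)) (half_pos hgap)
    (fun j hj => by linarith [hdesc j hj]) hanti
    (hlow.frequently.filter_mono hg)).mono_left hg
  have hnext : Tendsto (fun j => B (j + 1)) g (𝓝 Bstar) := by
    simpa using hBg.add hinc
  constructor
  · have h1 := (MatrixTISP.continuous_noIntercept.tendsto Bstar).comp hnext
    have h2 := ((MatrixTISP.continuousAt_matrixThreshold (hΘ.map_zero hlam) _ hcont).tendsto.comp
      (MatrixTISP.continuousAt_tispArg fam X Y hstar).tendsto).comp hBg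
    exact tendsto_nhds_unique h1 (h2.congr fun j => ((hB j).1).symm)
  · have h1 := (MatrixTISP.continuousAt_interceptScore fam X Y hstar).tendsto.comp hBg
    -- The score at `B^(j)` is the intercept increment, which vanishes in the limit.
    refine tendsto_nhds_unique (tendsto_pi_nhds.mp hinc 0) (h1.congr fun j => ?_)
    change _ = B (j + 1) 0 - B j 0
    rw [(hB j).2, add_sub_cancel_left]
    rfl
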